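/- Let $d\ge 3$ be an integer, let $S\subset\mathbb N$ be infinite, and for each $n\in S$ let $G_n=(V_n,E_n)$ be a simple $d$-regular graph on $n$ vertices. All limits are taken along $n\in S$, $n\to\infty$. Let $P_n(x,y)=\frac1d\mathbf 1_{\{x,y\}\in E_n}$ be the transition matrix of the simple random walk on $G_n$, and let $\rho_n$ be its spectral radius on functions with zero sum, i.e. its second largest eigenvalue in absolute value, counted with multiplicity. Put $$\eta_n=\max\Bigl(0,\ \frac{d\,\rho_n}{2\sqrt{d-1}}-1\Bigr).$$ For $\varepsilon\in(0,1)$ let $$T^{\mathrm{mix}}_n(\varepsilon)=\max_{x\in V_n}\inf\Bigl\{t\in\mathbb N:\ \tfrac12\sum_{y\in V_n}\bigl|P_n^t(x,y)-\tfrac1n\bigr|<\varepsilon\Bigr\}\in\mathbb N\cup\{\infty\}.$$ Let $\Phi:(0,1)\to\mathbb R$ be the inverse of the function $$s\mapsto \mathbb P\Bigl[Z\ge \frac{(d-2)^{3/2}\sqrt{\log(d-1)}}{2\sqrt{d(d-1)}}\,s\Bigr],$$ where $Z$ is a standard normal variable. Assume that $\eta_n\to0$. Then there exist a constant $C$ and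 a sequence $\delta_n\to0$ such that for all $\varepsilon\in(0,1)$ and all $n\in S$ sufficiently large (depending on $\varepsilon$), $T^{\mathrm{mix}}_n(\varepsilon)$ is finite and $$T^{\mathrm{mix}}_n(\varepsilon)\le\Bigl(\frac{d}{(d-2)\log(d-1)}+C\sqrt{\eta_n}\Bigr)\log n+(\Phi(\varepsilon)+\delta_n)\sqrt{\log n}.$$ In particular, if moreover $\eta_n\log n\to0$, then for every $\varepsilon\in(0,1)$ $$T^{\mathrm{mix}}_n(\varepsilon)=\frac{d}{(d-2)\log(d-1)}\log n+\Phi(\varepsilon)\sqrt{\log n}+o(\sqrt{\log n}).$$ -/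

import Mathlib

open Filter Topology Asymptotics ProbabilityTheory

namespace RegularGraphWalk

section Walk

variable {V : Type*} [Fintype V] [DecidableEq V]

/-- Transition matrix of the simple random walk on a `d`-regular graph `G`:
`P(x, y) = 1 / d` if `{x, y}` is an edge, and `0` otherwise. -/
noncomputable def transition (d : ℕ) (G : SimpleGraph V) [DecidableRel G.Adj] : Matrix V V ℝ :=
  Matrix.of fun x y => if G.Adj x y then 1 / (d : ℝ) else 0

/-- Total variation distance `d(x, t) = (1/2) ∑_y |P^t(x, y) - 1/#V|` between the law at time `t` of
the walk started at `x` and the uniform measure. -/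
noncomputable def tvDist (d : ℕ) (G : SimpleGraph V) [DecidableRel G.Adj] (x : V) (t : ℕ) : ℝ :=
  (1 / 2) * ∑ y, |(transition d G ^ t) x y - 1 / (Fintype.card V : ℝ)|

/-- Mixing time from `x`: the infimum in `ℕ ∪ {∞}` of the times `t` with `d(x, t) < ε`
(it is `∞` when there is no such time). -/
noncomputable def mixingTimeFrom (d : ℕ) (G : SimpleGraph V) [DecidableRel G.Adj]
    (x : V) (ε : ℝ) : ℕ∞ :=
  ⨅ (t : ℕ) (_ : tvDist d G x t < ε), (t : ℕ∞)

/-- Worst-case mixing time, with values in `ℕ ∪ {∞}`. -/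
noncomputable def mixingTime (d : ℕ) (G : SimpleGraph V) [DecidableRel G.Adj] (ε : ℝ) : ℕ∞ :=
  ⨆ x : V, mixingTimeFrom d G x ε

/-- Spectral radius of the transition matrix on functions with zero sum: the largest `|μ|` over the
eigenvalues `μ` of `P` with an eigenvector orthogonal to the constants. As `P` is symmetric and
fixes the constants, this is the second largest eigenvalue in absolute value, counted with
multiplicity. -/
noncomputable def spectralRadius₀ (d : ℕ) (G : SimpleGraph V) [DecidableRel G.Adj] : ℝ :=
  sSup {r : ℝ | ∃ (μ : ℝ) (f : V → ℝ), f ≠ 0 ∧ ∑ x, f x = 0 ∧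
    (transition d G).mulVec f = μ • f ∧ r = |μ|}

/-- `η = max(0, d ρ(G) / (2 √(d - 1)) - 1)`: by how much `G` fails to be a Ramanujan graph. -/
noncomputable def ramanujanDefect (d : ℕ) (G : SimpleGraph V) [DecidableRel G.Adj] : ℝ :=
  max 0 ((d : ℝ) * spectralRadius₀ d G / (2 * √((d : ℝ) - 1)) - 1)

end Walk

/-- The constant `(d - 2)^{3/2} √(log (d - 1)) / (2 √(d (d - 1)))`. -/
noncomputable def profileConst (d : ℕ) : ℝ :=
  ((d : ℝ) - 2) ^ (3 / 2 : ℝ) * √(Real.log ((d : ℝ) - 1)) / (2 * √((d : ℝ) * ((d : ℝ) - 1)))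

/-- The function `s ↦ ℙ[Z ≥ profileConst d * s]`, for `Z` a standard normal variable. -/
noncomputable def gaussianTail (d : ℕ) (s : ℝ) : ℝ :=
  (gaussianReal 0 1).real (Set.Ici (profileConst d * s))

/-- `Φ`, the inverse of `gaussianTail d`, which is a bijection from `ℝ` to `(0, 1)` for `d ≥ 3`
(values outside `(0, 1)` are irrelevant). -/
noncomputable def Φ (d : ℕ) : ℝ → ℝ :=
  Function.invFun (gaussianTail d)

lemma profileConst_pos {d : ℕ} (hd : 3 ≤ d) : 0 < profileConst d := by
  have h : (3 : ℝ) ≤ d := by exact_mod_cast hd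
  have h1 : 0 < Real.log ((d : ℝ) - 1) := Real.log_pos (by linarith)
  have h2 : 0 < (d : ℝ) * ((d : ℝ) - 1) := by nlinarith
  have h3 : 0 < (d : ℝ) - 2 := by linarith
  unfold profileConst
  positivity

lemma gaussianTail_eq (d : ℕ) (s : ℝ) :
    gaussianTail d s = 1 - cdf (gaussianReal 0 1) (profileConst d * s) := by
  have : MeasureTheory.NullSingletonClass (gaussianReal 0 1) :=
    nullSingletonClass_gaussianReal one_ne_zero
  rw [gaussianTail, cdf_eq_real, ← MeasureTheory.measureReal_congr MeasureTheory.Ioi_ae_eq_Ici,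
    ← Set.compl_Iic, MeasureTheory.probReal_compl_eq_one_sub measurableSet_Iic]

lemma continuous_cdf_gaussian : Continuous (cdf (gaussianReal 0 1)) := by
  have : MeasureTheory.NullSingletonClass (gaussianReal 0 1) :=
    nullSingletonClass_gaussianReal one_ne_zero
  rw [continuous_iff_continuousAt]
  intro x
  rw [(monotone_cdf _).continuousAt_iff_leftLim_eq_rightLim, StieltjesFunction.rightLim_eq]
  have h : (cdf (gaussianReal 0 1)).measure {x} = 0 := by
    rw [measure_cdf]; exact MeasureTheory.measure_singleton x
  rw [StieltjesFunction.measure_singleton, ENNReal.ofReal_eq_zero] at h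
  exact le_antisymm ((monotone_cdf _).leftLim_le le_rfl) (by linarith)

lemma strictMono_cdf_gaussian : StrictMono (cdf (gaussianReal 0 1)) := by
  intro a b hab
  have h : (cdf (gaussianReal 0 1)).measure (Set.Ioc a b) ≠ 0 := by
    rw [measure_cdf]
    intro h0
    have := gaussianReal_absolutelyContinuous' 0 (v := 1) one_ne_zero h0
    simp [Real.volume_Ioc] at this
    linarith
  rw [StieltjesFunction.measure_Ioc] at h
  by_contra hc
  exact h (ENNReal.ofReal_eq_zero.2 (by linarith))

/-- `gaussianTail d` is strictly decreasing, hence injective. -/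
lemma strictAnti_gaussianTail {d : ℕ} (hd : 3 ≤ d) : StrictAnti (gaussianTail d) := by
  intro a b hab
  rw [gaussianTail_eq, gaussianTail_eq]
  have := strictMono_cdf_gaussian (mul_lt_mul_of_pos_left hab (profileConst_pos hd))
  linarith

/-- `Φ d` is a right inverse of `gaussianTail d` on `(0, 1)`. -/
lemma gaussianTail_Φ {d : ℕ} (hd : 3 ≤ d) {ε : ℝ} (h0 : 0 < ε) (h1 : ε < 1) :
    gaussianTail d (Φ d ε) = ε := by
  apply Function.invFun_eq
  obtain ⟨y, hy⟩ : 1 - ε ∈ Set.range (cdf (gaussianReal 0 1)) := by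
    apply mem_range_of_exists_le_of_exists_ge continuous_cdf_gaussian
    · exact (((tendsto_cdf_atBot _).eventually_lt_const (sub_pos.2 h1)).exists).imp
        fun _ h => h.le
    · exact (((tendsto_cdf_atTop (gaussianReal 0 1)).eventually_const_lt
        (sub_lt_self 1 h0)).exists).imp fun _ h => h.le
  refine ⟨y / profileConst d, ?_⟩
  rw [gaussianTail_eq, mul_div_cancel₀ _ (profileConst_pos hd).ne', hy]
  ring

/-- `Φ d` is a left inverse of `gaussianTail d`. -/
lemma Φ_gaussianTail {d : ℕ} (hd : 3 ≤ d) (s : ℝ) : Φ d (gaussianTail d s) = s :=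
  Function.leftInverse_invFun (strictAnti_gaussianTail hd).injective s

end RegularGraphWalk

/-! Lift the walk to the `d`-regular tree covering the graph. Given its distance to the root, the
lifted walk is uniform on a sphere, so `P^t(x, ·)` is a mixture of the nonbacktracking laws `nbLaw
k`, weighted by the law of the distance at time `t` (`radialStep_pow_nbLaw`). That distance is, up
to bounded errors, a biased walk on `ℤ` with drift `(d-2)/d`, hence Gaussian on the scale `√t`.

The nonbacktracking walk mixes abruptly near length `log n / log (d-1)`. Its coefficients in an
eigenbasis of `P` satisfy the recurrence of the spherical functions. Under the spectral bound they
decay like `k (d-1)^(-k/2) exp(3k√η)`, and Cauchy-Schwarz costs a factor `√n`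
(`half_sum_abs_nbLaw_sub_le`). Conversely, walks of length at most `R` reach only `O(R (d-1)^R)`
vertices (`tvDist_ge`).

So the total variation distance is close to the probability that the biased walk is still below the
critical radius. The central limit theorem evaluates it as `gaussianTail d s` at time `d log n /
((d-2) log (d-1)) + s √(log n)`. The loss `exp(3k√η)` enlarges the radius by `O(√η log n)`, whence
the term `C √η log n`. A diagonal argument over finite grids of `s` makes `δ` independent of `ε`. -/

namespace RegularGraphWalk

/-! ### Biased walk on the integers and its central limit theorem. -/

section BiasedWalk

open MeasureTheory

/-- Distribution function of the position at time `t` of the walk on `ℤ` started at `0` which steps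
by `+1` with probability `p` and by `-1` with probability `1 - p`. -/
noncomputable def walkCdf (p : ℝ) : ℕ → ℝ → ℝ
  | 0, a => if 0 ≤ a then 1 else 0
  | t + 1, a => p * walkCdf p t (a - 1) + (1 - p) * walkCdf p t (a + 1)

lemma walkCdf_mono {p : ℝ} (h0 : 0 < p) (h1 : p < 1) (t : ℕ) : Monotone (walkCdf p t) := by
  induction t with
  | zero =>
    intro a b hab
    simp only [walkCdf]
    split_ifs <;> linarith
  | succ t ih =>
    intro a b hab
    simp only [walkCdf]
    have h2 : 0 < 1 - p := by linarith
    gcongr <;> exact ih (by linarith)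

/-- The law of one step of the biased walk. -/
noncomputable def stepLaw (p : ℝ) : Measure ℝ :=
  ENNReal.ofReal p • Measure.dirac 1 + ENNReal.ofReal (1 - p) • Measure.dirac (-1)

lemma isProbabilityMeasure_stepLaw {p : ℝ} (h0 : 0 < p) (h1 : p < 1) :
    IsProbabilityMeasure (stepLaw p) := by
  constructor
  simp [stepLaw, ← ENNReal.ofReal_add h0.le (sub_pos.2 h1).le]

lemma integral_stepLaw {p : ℝ} (h0 : 0 < p) (h1 : p < 1) (f : ℝ → ℝ) :
    ∫ x, f x ∂(stepLaw p) = p * f 1 + (1 - p) * f (-1) := by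
  rw [stepLaw, integral_add_measure, integral_smul_measure, integral_smul_measure, integral_dirac,
    integral_dirac, ENNReal.toReal_ofReal h0.le, ENNReal.toReal_ofReal (sub_pos.2 h1).le]
  · simp
  · exact (integrable_dirac (by simp)).smul_measure ENNReal.ofReal_ne_top
  · exact (integrable_dirac (by simp)).smul_measure ENNReal.ofReal_ne_top

variable {Ω : Type*} [MeasurableSpace Ω] {P : Measure Ω} {X : ℕ → Ω → ℝ}

lemma stepLaw_real_one {p : ℝ} (h0 : 0 < p) :
    (stepLaw p).real {1} = p := by
  have h : (Pi.single (1 : ℝ) (1 : ENNReal) : ℝ → ENNReal) (-1) = 0 :=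
    Pi.single_eq_of_ne (by norm_num) _
  simp [stepLaw, Measure.real, h, h0.le]

lemma stepLaw_real_neg_one {p : ℝ} (h1 : p < 1) :
    (stepLaw p).real {-1} = 1 - p := by
  have h : (Pi.single (-1 : ℝ) (1 : ENNReal) : ℝ → ENNReal) 1 = 0 :=
    Pi.single_eq_of_ne (by norm_num) _
  simp [stepLaw, Measure.real, h, h1.le]

/-- Conditioning on the last step gives the recursion defining `walkCdf`. This identifies the
recursion with genuine i.i.d. sums, to which the central limit theorem applies. -/
lemma measure_sum_le_eq_walkCdf [IsProbabilityMeasure P] {p : ℝ} (h0 : 0 < p) (h1 : p < 1)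
    (hm : ∀ i, Measurable (X i)) (hlaw : ∀ i, HasLaw (X i) (stepLaw p) P) (hind : iIndepFun X P)
    (t : ℕ) (a : ℝ) :
    P.real {ω | ∑ i ∈ Finset.range t, X i ω ≤ a} = walkCdf p t a := by
  induction t generalizing a with
  | zero =>
    by_cases h : 0 ≤ a <;> simp [walkCdf, h]
  | succ t ih =>
    have hS : Measurable (fun ω => ∑ i ∈ Finset.range t, X i ω) :=
      Finset.measurable_fun_sum _ fun i _ => hm i
    have hI : IndepFun (fun ω => ∑ i ∈ Finset.range t, X i ω) (X t) P := by
      have := hind.indepFun_finsetSum_of_notMem hm (s := Finset.range t) (i := t) (by simp)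
      convert this using 1
      ext ω
      simp
    have key (x b : ℝ) : P.real ({ω | ∑ i ∈ Finset.range t, X i ω ≤ b} ∩ X t ⁻¹' {x})
        = (stepLaw p).real {x} * walkCdf p t b := by
      have := hI.measure_inter_preimage_eq_mul (Set.Iic b) {x} measurableSet_Iic
        (measurableSet_singleton x)
      rw [← ih, measureReal_def, ← (hlaw t).map_eq]
      change P ({ω | ∑ i ∈ Finset.range t, X i ω ≤ b} ∩ X t ⁻¹' {x}) = _ at this
      rw [this, ENNReal.toReal_mul, measureReal_def, measureReal_def,
        Measure.map_apply (hm t) (measurableSet_singleton x), mul_comm]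
      rfl
    have hae : ∀ᵐ ω ∂P, X t ω = 1 ∨ X t ω = -1 := by
      have : ∀ᵐ x ∂(stepLaw p), x = 1 ∨ x = -1 := by
        rw [stepLaw, ae_add_measure_iff]
        constructor <;> apply Measure.ae_smul_measure <;> simp [ae_dirac_eq]
      rw [← (hlaw t).map_eq] at this
      exact ae_of_ae_map (hm t).aemeasurable this
    have hset : {ω | ∑ i ∈ Finset.range (t + 1), X i ω ≤ a} =ᵐ[P]
        (({ω | ∑ i ∈ Finset.range t, X i ω ≤ a - 1} ∩ X t ⁻¹' {1}) ∪
          ({ω | ∑ i ∈ Finset.range t, X i ω ≤ a + 1} ∩ X t ⁻¹' {-1}) : Set Ω) := by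
      filter_upwards [hae] with ω hω
      apply propext
      change ∑ i ∈ Finset.range (t + 1), X i ω ≤ a ↔
        (∑ i ∈ Finset.range t, X i ω ≤ a - 1 ∧ X t ω = 1) ∨
        (∑ i ∈ Finset.range t, X i ω ≤ a + 1 ∧ X t ω = -1)
      rw [Finset.sum_range_succ]
      rcases hω with h | h <;> rw [h] <;> norm_num <;>
        constructor <;> intro h <;> linarith
    rw [measureReal_congr hset, measureReal_union, key, key, stepLaw_real_one h0,
      stepLaw_real_neg_one h1, walkCdf]
    · rw [Set.disjoint_left]
      rintro ω ⟨_, h⟩ ⟨_, h'⟩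
      simp only [Set.mem_preimage, Set.mem_singleton_iff] at h h'
      linarith
    · exact (measurableSet_le hS measurable_const).inter (hm t (measurableSet_singleton _))

/-- Central limit theorem for the biased walk, at a fixed endpoint. -/
lemma tendsto_walkCdf_const {p : ℝ} (h0 : 0 < p) (h1 : p < 1) (c : ℝ) :
    Tendsto (fun t : ℕ => walkCdf p t (t * (2 * p - 1) + √(4 * p * (1 - p)) * √t * c)) atTop
      (𝓝 (cdf (gaussianReal 0 1) c)) := by
  have := isProbabilityMeasure_stepLaw h0 h1
  obtain ⟨Ω, _, P, X, hm, hlaw, hind, _⟩ := exists_iid ℕ (stepLaw p)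
  set σ := √(4 * p * (1 - p)) with hσ
  have hpos : 0 < 4 * p * (1 - p) := mul_pos (by linarith) (by linarith)
  have hσ0 : 0 < σ := Real.sqrt_pos.2 hpos
  have hσ2 : σ ^ 2 = 4 * p * (1 - p) := Real.sq_sqrt hpos.le
  -- Standardized step: one step has mean `2p - 1` and variance `4p(1 - p)`.
  let u : ℝ → ℝ := fun x => (x - (2 * p - 1)) / σ
  have hu : Measurable u := by fun_prop
  have hint (f : ℝ → ℝ) (hf : Measurable f) :
      ∫ ω, f (X 0 ω) ∂P = p * f 1 + (1 - p) * f (-1) := by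
    rw [← integral_stepLaw h0 h1, ← (hlaw 0).map_eq,
      integral_map (hm 0).aemeasurable hf.aestronglyMeasurable]
  have hY : HasLaw (id : ℝ → ℝ) (gaussianReal 0 1) (gaussianReal 0 1) := HasLaw.id
  have clt := tendstoInDistribution_inv_sqrt_mul_sum (P := P) (X := fun i ω => u (X i ω)) hY
    (by
      rw [hint u hu]
      simp only [u]
      field_simp
      ring)
    (by
      change ∫ ω, (u (X 0 ω)) ^ 2 ∂P = 1
      rw [hint (fun x => u x ^ 2) (by fun_prop)]
      simp only [u]
      field_simp
      rw [hσ2]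
      ring)
    (hind.comp (fun _ => u) fun _ => hu)
    (fun i => ((hlaw i).identDistrib (hlaw 0)).comp hu)
  have hfr : (gaussianReal 0 1) (frontier (Set.Iic c)) = 0 := by
    have : MeasureTheory.NullSingletonClass (gaussianReal 0 1) :=
      nullSingletonClass_gaussianReal one_ne_zero
    rw [frontier_Iic]
    exact measure_singleton c
  have h := ProbabilityMeasure.tendsto_measure_of_null_frontier_of_tendsto' clt.tendsto
    (E := Set.Iic c) (by simpa using hfr)
  have h' := (ENNReal.tendsto_toReal (by simp)).comp h
  rw [cdf_eq_real]
  have e : ((gaussianReal 0 1).map (id : ℝ → ℝ)) = gaussianReal 0 1 := Measure.map_id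
  simp only [ProbabilityMeasure.coe_mk, e] at h'
  refine h'.congr' ?_
  filter_upwards [eventually_gt_atTop 0] with t ht
  have htpos : (0 : ℝ) < t := by exact_mod_cast ht
  have hst : 0 < √(t : ℝ) := Real.sqrt_pos.2 htpos
  simp only [Function.comp_apply]
  rw [← measure_sum_le_eq_walkCdf h0 h1 hm hlaw hind, Measure.map_apply (by fun_prop)
    measurableSet_Iic, measureReal_def]
  congr 2
  ext ω
  simp only [Set.mem_preimage, Set.mem_Iic, Set.mem_ofPred_eq, u]
  rw [← Finset.sum_div, Finset.sum_sub_distrib, inv_mul_le_iff₀ hst, div_le_iff₀ hσ0]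
  simp only [Finset.sum_const, Finset.card_range, nsmul_eq_mul]
  constructor <;> intro h <;> nlinarith

/-- Central limit theorem for the biased walk, along a filter and with a varying endpoint. -/
lemma tendsto_walkCdf {ι : Type*} {l : Filter ι} {p : ℝ} (h0 : 0 < p) (h1 : p < 1) {t : ι → ℕ}
    (ht : Tendsto t l atTop) {a : ι → ℝ} {c : ℝ}
    (ha : Tendsto (fun i => (a i - t i * (2 * p - 1)) / (√(4 * p * (1 - p)) * √(t i))) l (𝓝 c)) :
    Tendsto (fun i => walkCdf p (t i) (a i)) l (𝓝 (cdf (gaussianReal 0 1) c)) := by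
  have hσ0 : 0 < √(4 * p * (1 - p)) :=
    Real.sqrt_pos.2 (mul_pos (by linarith) (by linarith))
  have hcont := continuous_cdf_gaussian
  rw [tendsto_order]
  have hne : ∀ᶠ i in l, 0 < √(t i : ℝ) := by
    filter_upwards [ht.eventually_gt_atTop 0] with i hi
    exact Real.sqrt_pos.2 (by exact_mod_cast hi)
  constructor
  · intro b hb
    -- A fixed endpoint `x < c` is eventually below the varying one, so monotonicity of `walkCdf`
    -- reduces to the fixed-endpoint limit.
    have h2 : ∀ᶠ x in 𝓝[<] c, b < cdf (gaussianReal 0 1) x :=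
      (hcont.continuousAt.eventually (eventually_gt_nhds hb)).filter_mono nhdsWithin_le_nhds
    obtain ⟨x, hx, hxc⟩ := (h2.and self_mem_nhdsWithin).exists
    filter_upwards [((tendsto_walkCdf_const h0 h1 x).comp ht).eventually (eventually_gt_nhds hx),
      ha.eventually (eventually_gt_nhds hxc), hne] with i hi hai hti
    refine lt_of_lt_of_le hi (walkCdf_mono h0 h1 _ ?_)
    rw [lt_div_iff₀ (mul_pos hσ0 hti)] at hai
    nlinarith
  · intro b hb
    have h2 : ∀ᶠ x in 𝓝[>] c, cdf (gaussianReal 0 1) x < b :=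
      (hcont.continuousAt.eventually (eventually_lt_nhds hb)).filter_mono nhdsWithin_le_nhds
    obtain ⟨x, hx, hxc⟩ := (h2.and self_mem_nhdsWithin).exists
    filter_upwards [((tendsto_walkCdf_const h0 h1 x).comp ht).eventually (eventually_lt_nhds hx),
      ha.eventually (eventually_lt_nhds hxc), hne] with i hi hai hti
    refine lt_of_le_of_lt (walkCdf_mono h0 h1 _ ?_) hi
    rw [div_lt_iff₀ (mul_pos hσ0 hti)] at hai
    nlinarith

end BiasedWalk

/-! ### Distance to the root on the tree, compared with the biased walk. -/

section Radial

/-- Transition operator of the distance to the root of the simple random walk on the `d`-regular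
tree. -/
noncomputable def radialStep (d : ℕ) : (ℕ → ℝ) →ₗ[ℝ] (ℕ → ℝ) where
  toFun f k := match k with
    | 0 => f 1
    | k + 1 => 1 / d * f k + (d - 1) / d * f (k + 2)
  map_add' f g := by
    ext k
    cases k <;> simp [mul_add] <;> ring
  map_smul' c f := by
    ext k
    cases k <;> simp [mul_add] <;> ring

@[simp] lemma radialStep_zero (d : ℕ) (f : ℕ → ℝ) : radialStep d f 0 = f 1 := rfl

@[simp] lemma radialStep_succ (d : ℕ) (f : ℕ → ℝ) (k : ℕ) :
    radialStep d f (k + 1) = 1 / d * f k + (d - 1) / d * f (k + 2) := rfl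

variable {d : ℕ}

lemma radialStep_mono (hd : 3 ≤ d) {f g : ℕ → ℝ} (h : f ≤ g) :
    radialStep d f ≤ radialStep d g := by
  have h3 : (3 : ℝ) ≤ d := by exact_mod_cast hd
  have h1 : (0 : ℝ) ≤ d - 1 := by linarith
  intro k
  cases k with
  | zero => exact h 1
  | succ k =>
    simp only [radialStep_succ]
    have := h k
    have := h (k + 2)
    gcongr

lemma radialStep_pow_mono (hd : 3 ≤ d) (t : ℕ) {f g : ℕ → ℝ} (h : f ≤ g) :
    (radialStep d ^ t) f ≤ (radialStep d ^ t) g := by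
  induction t generalizing f g with
  | zero => simpa using h
  | succ t ih =>
    simp only [pow_succ, Module.End.mul_apply]
    exact ih (radialStep_mono hd h)

lemma radialStep_const (hd : 3 ≤ d) (c : ℝ) : radialStep d (fun _ => c) = fun _ => c := by
  have h3 : (3 : ℝ) ≤ d := by exact_mod_cast hd
  ext k
  cases k with
  | zero => rfl
  | succ k =>
    simp only [radialStep_succ]
    field_simp
    ring

lemma radialStep_pow_const (hd : 3 ≤ d) (t : ℕ) (c : ℝ) :
    (radialStep d ^ t) (fun _ => c) = fun _ => c := by
  induction t with
  | zero => simp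
  | succ t ih => rw [pow_succ, Module.End.mul_apply, radialStep_const hd, ih]

lemma abs_radialStep_pow_le (hd : 3 ≤ d) (t : ℕ) (f : ℕ → ℝ) (k : ℕ) :
    |(radialStep d ^ t) f k| ≤ (radialStep d ^ t) (fun j => |f j|) k := by
  rw [abs_le]
  constructor
  · have := radialStep_pow_mono hd t (f := fun j => -|f j|) (g := f) (fun j => neg_abs_le _) k
    have e : (fun j => -|f j|) = -(fun j => |f j|) := rfl
    rw [e, map_neg] at this
    exact this
  · exact radialStep_pow_mono hd t (f := f) (fun j => le_abs_self _) k

/-- Indicator function of `{k | k ≤ r}`. -/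
noncomputable def ballInd (r : ℝ) (k : ℕ) : ℝ := if (k : ℝ) ≤ r then 1 else 0

lemma ballInd_nonneg (r : ℝ) (k : ℕ) : 0 ≤ ballInd r k := by
  unfold ballInd
  split_ifs <;> norm_num

lemma prob_pos_lt (hd : 3 ≤ d) : 0 < ((d : ℝ) - 1) / d ∧ ((d : ℝ) - 1) / d < 1 := by
  have h3 : (3 : ℝ) ≤ d := by exact_mod_cast hd
  refine ⟨div_pos (by linarith) (by linarith), ?_⟩
  rw [div_lt_one (by linarith)]
  linarith

lemma walkCdf_zero_sub (p r : ℝ) (k : ℕ) : walkCdf p 0 (r - k) = ballInd r k := by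
  simp [walkCdf, ballInd]

lemma walkCdf_succ_sub (hd : 3 ≤ d) (t : ℕ) (a : ℝ) :
    walkCdf (((d : ℝ) - 1) / d) (t + 1) a =
      1 / d * walkCdf (((d : ℝ) - 1) / d) t (a + 1)
        + ((d : ℝ) - 1) / d * walkCdf (((d : ℝ) - 1) / d) t (a - 1) := by
  have h3 : (3 : ℝ) ≤ d := by exact_mod_cast hd
  have : 1 - ((d : ℝ) - 1) / d = 1 / d := by field_simp; ring
  rw [walkCdf, this, add_comm]

/-- The distance to the root dominates the biased walk. -/
lemma radialStep_pow_ballInd_le (hd : 3 ≤ d) (r : ℝ) (t k : ℕ) :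
    (radialStep d ^ t) (ballInd r) k ≤ walkCdf (((d : ℝ) - 1) / d) t (r - k) := by
  have h3 : (3 : ℝ) ≤ d := by exact_mod_cast hd
  have h1 : (0 : ℝ) ≤ d - 1 := by linarith
  obtain ⟨p0, p1⟩ := prob_pos_lt hd
  induction t generalizing k with
  | zero => simp [walkCdf_zero_sub]
  | succ t ih =>
    rw [pow_succ', Module.End.mul_apply, walkCdf_succ_sub hd]
    cases k with
    -- The processes differ only here: the radial walk is reflected to `1`, where the biased walk
    -- might go to `-1`.
    | zero =>
      rw [radialStep_zero]
      refine (ih 1).trans ?_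
      have hm := walkCdf_mono p0 p1 t (show r - 1 ≤ r + 1 by linarith)
      have e : (1 : ℝ) / d + ((d : ℝ) - 1) / d = 1 := by field_simp; ring
      have hd0 := mul_le_mul_of_nonneg_left hm (show (0 : ℝ) ≤ 1 / d by positivity)
      simp only [Nat.cast_zero, Nat.cast_one, sub_zero]
      have e' := congrArg (· * walkCdf (((d : ℝ) - 1) / d) t (r - 1)) e
      simp only [add_mul, one_mul] at e'
      linarith
    | succ k =>
      rw [radialStep_succ]
      have e1 : r - ((k + 1 : ℕ) : ℝ) + 1 = r - k := by push_cast; ring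
      have e2 : r - ((k + 1 : ℕ) : ℝ) - 1 = r - (k + 2 : ℕ) := by push_cast; ring
      rw [e1, e2]
      have := ih k
      have := ih (k + 2)
      gcongr

/-- The two processes agree until they hit `0`, and `(d-1)^(-k)` is the probability that the biased
walk from `k` ever does. It is harmonic for that walk (`e3`), and at `k = 0` the bound is trivial.
-/
lemma radialStep_pow_ballInd_ge (hd : 3 ≤ d) (r : ℝ) (t k : ℕ) :
    walkCdf (((d : ℝ) - 1) / d) t (r - k) - (((d : ℝ) - 1)⁻¹) ^ k
      ≤ (radialStep d ^ t) (ballInd r) k := by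
  have h3 : (3 : ℝ) ≤ d := by exact_mod_cast hd
  have h1 : (0 : ℝ) < d - 1 := by linarith
  obtain ⟨p0, p1⟩ := prob_pos_lt hd
  have hw1 (t : ℕ) (a : ℝ) : walkCdf (((d : ℝ) - 1) / d) t a ≤ 1 := by
    induction t generalizing a with
    | zero =>
      simp only [walkCdf]
      split_ifs <;> norm_num
    | succ t ih =>
      rw [walkCdf]
      nlinarith [ih (a - 1), ih (a + 1)]
  induction t generalizing k with
  | zero =>
    have : 0 ≤ (((d : ℝ) - 1)⁻¹) ^ k := by positivity
    simp only [walkCdf_zero_sub, pow_zero, Module.End.one_apply]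
    linarith
  | succ t ih =>
    cases k with
    | zero =>
      have h0 := radialStep_pow_mono hd (t + 1) (f := fun _ => 0) (fun k => ballInd_nonneg r k) 0
      rw [radialStep_pow_const hd] at h0
      have := hw1 (t + 1) (r - (0 : ℕ))
      simp only [pow_zero]
      linarith
    | succ k =>
      rw [pow_succ' (radialStep d), Module.End.mul_apply, walkCdf_succ_sub hd, radialStep_succ]
      have e1 : r - ((k + 1 : ℕ) : ℝ) + 1 = r - k := by push_cast; ring
      have e2 : r - ((k + 1 : ℕ) : ℝ) - 1 = r - (k + 2 : ℕ) := by push_cast; ring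
      have e3 : (((d : ℝ) - 1)⁻¹) ^ (k + 1)
          = 1 / d * (((d : ℝ) - 1)⁻¹) ^ k + (d - 1) / d * (((d : ℝ) - 1)⁻¹) ^ (k + 2) := by
        rw [pow_add, pow_add]
        field_simp
        ring
      rw [e1, e2, e3]
      have a1 := mul_le_mul_of_nonneg_left (ih k) (show (0 : ℝ) ≤ 1 / d by positivity)
      have a2 := mul_le_mul_of_nonneg_left (ih (k + 2)) p0.le
      rw [mul_sub] at a1 a2
      linarith

/-- Radial walks of equal parity can be coupled without crossing. A shift by one would fail because
of the reflection at `0`. -/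
lemma radialStep_pow_ballInd_add_two_le (hd : 3 ≤ d) (r : ℝ) (t k : ℕ) :
    (radialStep d ^ t) (ballInd r) (k + 2) ≤ (radialStep d ^ t) (ballInd r) k := by
  have h3 : (3 : ℝ) ≤ d := by exact_mod_cast hd
  have h1 : (0 : ℝ) ≤ d - 1 := by linarith
  induction t generalizing k with
  | zero =>
    simp only [pow_zero, Module.End.one_apply, ballInd]
    push_cast
    split_ifs <;> linarith
  | succ t ih =>
    simp only [pow_succ', Module.End.mul_apply]
    cases k with
    | zero =>
      rw [zero_add, radialStep_zero, radialStep_succ]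
      have := ih 1
      have e : (1 : ℝ) / d + ((d : ℝ) - 1) / d = 1 := by field_simp; ring
      have hd0 := mul_le_mul_of_nonneg_left this (show (0 : ℝ) ≤ ((d : ℝ) - 1) / d by positivity)
      simp only [Nat.reduceAdd] at *
      rw [eq_sub_of_add_eq e, sub_mul]
      linarith
    | succ k =>
      rw [show k + 1 + 2 = (k + 2) + 1 by ring, radialStep_succ, radialStep_succ]
      have := ih k
      have := ih (k + 2)
      gcongr

/-- The distance to the root exceeds the biased walk by at most `2 m`, up to an exponentially small
probability. -/
lemma walkCdf_sub_le_radialStep_pow (hd : 3 ≤ d) (r : ℝ) (t m : ℕ) :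
    walkCdf (((d : ℝ) - 1) / d) t (r - (2 * m : ℕ)) - (((d : ℝ) - 1)⁻¹) ^ (2 * m)
      ≤ (radialStep d ^ t) (ballInd r) 0 := by
  refine (radialStep_pow_ballInd_ge hd r t (2 * m)).trans ?_
  induction m with
  | zero => rfl
  | succ m ih => exact (radialStep_pow_ballInd_add_two_le hd r t (2 * m)).trans ih

end Radial

/-! ### Nonbacktracking walks and the mixture formula. -/

section Nonbacktracking

variable {V : Type*} [Fintype V] [DecidableEq V] (d : ℕ) (G : SimpleGraph V) [DecidableRel G.Adj]
  (x : V)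

/-- Number of nonbacktracking walks from `x` of length `k + 1` with last step `y → z`. -/
def nbEdgeCount : ℕ → V → V → ℕ
  | 0, y, z => if y = x ∧ G.Adj y z then 1 else 0
  | k + 1, y, z => if G.Adj y z then ∑ w ∈ Finset.univ.erase z, nbEdgeCount k w y else 0

/-- Number of nonbacktracking walks of length `k` from `x` to `z`. -/
def nbCount : ℕ → V → ℕ
  | 0, z => if z = x then 1 else 0
  | k + 1, z => ∑ y, nbEdgeCount G x k y z

lemma nbEdgeCount_of_not_adj (k : ℕ) {y z : V} (h : ¬ G.Adj y z) : nbEdgeCount G x k y z = 0 := by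
  cases k <;> simp [nbEdgeCount, h]

lemma sum_nbCount_adj_zero (z : V) :
    ∑ y, (if G.Adj y z then nbCount G x 0 y else 0) = nbCount G x 1 z := by
  simp only [nbCount, nbEdgeCount]
  refine Finset.sum_congr rfl fun y _ => ?_
  by_cases h : G.Adj y z <;> simp [h]

/-- A nonbacktracking walk extended by a step into `z` either stays nonbacktracking, or had just
crossed the same edge from `z`. -/
lemma sum_nbCount_adj_succ (k : ℕ) (z : V) :
    ∑ y, (if G.Adj y z then nbCount G x (k + 1) y else 0)
      = nbCount G x (k + 2) z + ∑ y, nbEdgeCount G x k z y := by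
  rw [nbCount, ← Finset.sum_add_distrib]
  refine Finset.sum_congr rfl fun y _ => ?_
  by_cases h : G.Adj y z
  · simp only [h, if_true, nbCount, nbEdgeCount]
    rw [Finset.sum_erase_add _ _ (Finset.mem_univ z)]
  · rw [nbEdgeCount_of_not_adj G x k (fun h' => h h'.symm)]
    simp [nbEdgeCount, h]

variable {d G}

lemma card_adj (hreg : G.IsRegularOfDegree d) (z : V) :
    (Finset.univ.filter fun y => G.Adj z y).card = d := by
  rw [← G.neighborFinset_eq_filter, G.card_neighborFinset_eq_degree, hreg z]

lemma sum_nbEdgeCount_zero (hreg : G.IsRegularOfDegree d) (z : V) :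
    ∑ y, nbEdgeCount G x 0 z y = d * nbCount G x 0 z := by
  simp only [nbEdgeCount, nbCount]
  by_cases h : z = x
  · subst h
    simp [card_adj hreg]
  · simp [h]

/-- Each walk arriving at `z` has `d - 1` continuations. The added term stands for the one forbidden
step back and avoids subtraction in `ℕ`. -/
lemma sum_nbEdgeCount_succ (hreg : G.IsRegularOfDegree d) (k : ℕ) (z : V) :
    ∑ y, nbEdgeCount G x (k + 1) z y + nbCount G x (k + 1) z = d * nbCount G x (k + 1) z := by
  have h1 : nbCount G x (k + 1) z = ∑ y, if G.Adj z y then nbEdgeCount G x k y z else 0 := by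
    rw [nbCount]
    refine Finset.sum_congr rfl fun y _ => ?_
    split_ifs with h
    · rfl
    · exact nbEdgeCount_of_not_adj G x k fun h' => h h'.symm
  conv_lhs => rw [h1]
  rw [← Finset.sum_add_distrib]
  trans ∑ y, if G.Adj z y then nbCount G x (k + 1) z else 0
  · refine Finset.sum_congr rfl fun y _ => ?_
    by_cases h : G.Adj z y
    · simp only [h, if_true, nbCount, nbEdgeCount]
      rw [Finset.sum_erase_add _ _ (Finset.mem_univ y)]
    · simp [nbEdgeCount, h]
  · rw [← Finset.sum_filter, Finset.sum_const, card_adj hreg, smul_eq_mul]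

variable (d G)

/-- Law of the endpoint of a uniform nonbacktracking walk of length `k` from `x`. -/
noncomputable def nbLaw (k : ℕ) (z : V) : ℝ :=
  match k with
  | 0 => nbCount G x 0 z
  | k + 1 => nbCount G x (k + 1) z / (d * ((d : ℝ) - 1) ^ k)

/-- The row vector `f P`. -/
noncomputable def stepVec (f : V → ℝ) (z : V) : ℝ := ∑ y, f y * transition d G y z

lemma stepVec_natCast (f : V → ℕ) (c : ℝ) (z : V) :
    stepVec d G (fun y => f y * c) z = (∑ y, (if G.Adj y z then f y else 0) : ℕ) * c / d := by
  simp only [stepVec, transition, Matrix.of_apply]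
  push_cast
  rw [Finset.sum_mul, Finset.sum_div]
  refine Finset.sum_congr rfl fun y _ => ?_
  split_ifs
  · ring
  · simp

variable {d G}

lemma stepVec_nbLaw_zero : stepVec d G (nbLaw d G x 0) = nbLaw d G x 1 := by
  ext z
  have := stepVec_natCast d G (nbCount G x 0) 1 z
  simp only [mul_one, sum_nbCount_adj_zero] at this
  rw [show nbLaw d G x 0 = fun y => (nbCount G x 0 y : ℝ) from rfl, this]
  simp [nbLaw]

lemma stepVec_nbLaw_succ (hd : 3 ≤ d) (hreg : G.IsRegularOfDegree d) (k : ℕ) (z : V) :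
    stepVec d G (nbLaw d G x (k + 1)) z
      = 1 / d * nbLaw d G x k z + (d - 1) / d * nbLaw d G x (k + 2) z := by
  have h3 : (3 : ℝ) ≤ d := by exact_mod_cast hd
  have h1 : (0 : ℝ) < d - 1 := by linarith
  have := stepVec_natCast d G (nbCount G x (k + 1)) (1 / (d * ((d : ℝ) - 1) ^ k)) z
  rw [sum_nbCount_adj_succ] at this
  rw [show nbLaw d G x (k + 1) = fun y => nbCount G x (k + 1) y * (1 / (d * ((d : ℝ) - 1) ^ k)) by
    ext y; simp [nbLaw, div_eq_mul_inv], this]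
  -- At `k = 0` the cancelled walk has length `0` and `d` continuations instead of `d - 1`; the
  -- normalization of `nbLaw` changes accordingly.
  cases k with
  | zero =>
    rw [sum_nbEdgeCount_zero x hreg]
    simp only [nbLaw]
    push_cast
    field_simp
    ring
  | succ k =>
    have h := sum_nbEdgeCount_succ x hreg k z
    have h' : ((∑ y, nbEdgeCount G x (k + 1) z y : ℕ) : ℝ)
        = (d - 1) * nbCount G x (k + 1) z := by
      have : ((∑ y, nbEdgeCount G x (k + 1) z y : ℕ) : ℝ) + nbCount G x (k + 1) z
        = d * nbCount G x (k + 1) z := by exact_mod_cast h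
      linarith
    rw [Nat.cast_add, h']
    simp only [nbLaw]
    field_simp
    ring

lemma transition_symm (y z : V) : transition d G y z = transition d G z y := by
  simp [transition, G.adj_comm]

lemma transition_nonneg (y z : V) : 0 ≤ transition d G y z := by
  simp only [transition, Matrix.of_apply]
  split_ifs <;> positivity

lemma sum_transition (hd : 3 ≤ d) (hreg : G.IsRegularOfDegree d) (y : V) :
    ∑ z, transition d G y z = 1 := by
  have h3 : (3 : ℝ) ≤ d := by exact_mod_cast hd
  simp only [transition, Matrix.of_apply]
  rw [← Finset.sum_filter, Finset.sum_const, card_adj hreg, nsmul_eq_mul]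
  field_simp

lemma nbLaw_nonneg (hd : 3 ≤ d) (k : ℕ) (z : V) : 0 ≤ nbLaw d G x k z := by
  have h3 : (3 : ℝ) ≤ d := by exact_mod_cast hd
  have h1 : (0 : ℝ) < d - 1 := by linarith
  cases k <;> simp only [nbLaw] <;> positivity

lemma sum_stepVec (hd : 3 ≤ d) (hreg : G.IsRegularOfDegree d) (f : V → ℝ) :
    ∑ z, stepVec d G f z = ∑ z, f z := by
  simp only [stepVec]
  rw [Finset.sum_comm]
  refine Finset.sum_congr rfl fun y _ => ?_
  rw [← Finset.mul_sum, sum_transition hd hreg, mul_one]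

lemma stepVec_const (hd : 3 ≤ d) (hreg : G.IsRegularOfDegree d) (c : ℝ) :
    stepVec d G (fun _ => c) = fun _ => c := by
  ext z
  simp only [stepVec]
  simp_rw [transition_symm _ z]
  rw [← Finset.mul_sum, sum_transition hd hreg, mul_one]

lemma sum_nbLaw (hd : 3 ≤ d) (hreg : G.IsRegularOfDegree d) (k : ℕ) :
    ∑ z, nbLaw d G x k z = 1 := by
  have h3 : (3 : ℝ) ≤ d := by exact_mod_cast hd
  have h0 : ∑ z, nbLaw d G x 0 z = 1 := by simp [nbLaw, nbCount]
  suffices h : ∀ k, ∑ z, nbLaw d G x k z = 1 ∧ ∑ z, nbLaw d G x (k + 1) z = 1 from (h k).1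
  intro k
  induction k with
  | zero => exact ⟨h0, by rw [← stepVec_nbLaw_zero, sum_stepVec hd hreg, h0]⟩
  | succ k ih =>
    refine ⟨ih.2, ?_⟩
    have h := sum_stepVec hd hreg (nbLaw d G x (k + 1))
    simp_rw [stepVec_nbLaw_succ x hd hreg] at h
    rw [Finset.sum_add_distrib, ← Finset.mul_sum, ← Finset.mul_sum, ih.1, ih.2] at h
    field_simp at h
    have h1 : ((d : ℝ) - 1) ≠ 0 := by linarith
    apply mul_left_cancel₀ h1
    linarith

/-- Intertwining: a radial step on the length index is a step of `P` on the vertices. -/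
lemma radialStep_sum_mul_nbLaw (hd : 3 ≤ d) (hreg : G.IsRegularOfDegree d) (g : V → ℝ) :
    radialStep d (fun k => ∑ y, nbLaw d G x k y * g y)
      = fun k => ∑ y, stepVec d G (nbLaw d G x k) y * g y := by
  ext k
  cases k with
  | zero => simp [stepVec_nbLaw_zero]
  | succ k =>
    simp only [radialStep_succ, stepVec_nbLaw_succ x hd hreg]
    rw [Finset.mul_sum, Finset.mul_sum, ← Finset.sum_add_distrib]
    refine Finset.sum_congr rfl fun y _ => ?_
    ring

/-- The simple random walk at time `t` is a mixture of nonbacktracking walks, weighted by the law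
of the distance to the root on the tree. -/
lemma radialStep_pow_nbLaw (hd : 3 ≤ d) (hreg : G.IsRegularOfDegree d) (t : ℕ) (z : V) :
    (radialStep d ^ t) (fun k => nbLaw d G x k z) 0 = (transition d G ^ t) x z := by
  -- An arbitrary right factor `M` lets the induction absorb one factor `P` at a time.
  have h (M : Matrix V V ℝ) :
      (radialStep d ^ t) (fun k => ∑ y, nbLaw d G x k y * M y z)
        = fun k => ∑ y, nbLaw d G x k y * (transition d G ^ t * M) y z := by
    induction t generalizing M with
    | zero => simp
    | succ t ih =>
      rw [pow_succ, Module.End.mul_apply, radialStep_sum_mul_nbLaw x hd hreg, pow_succ,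
        Matrix.mul_assoc, ← ih]
      congr 1
      ext k
      simp only [stepVec, Matrix.mul_apply, Finset.sum_mul, Finset.mul_sum]
      rw [Finset.sum_comm]
      simp only [mul_assoc]
  have h1 := congrFun (h 1) 0
  simp only [Matrix.one_apply, mul_one] at h1
  simpa [nbLaw, nbCount] using h1

end Nonbacktracking

/-! ### Total variation bounds in terms of the radial process. -/

section TotalVariation

variable {V : Type*} [Fintype V] [DecidableEq V] {d : ℕ} {G : SimpleGraph V} [DecidableRel G.Adj]

lemma sum_transition_pow (hd : 3 ≤ d) (hreg : G.IsRegularOfDegree d) (t : ℕ) (x : V) :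
    ∑ y, (transition d G ^ t) x y = 1 := by
  induction t with
  | zero => simp [Matrix.one_apply]
  | succ t ih =>
    rw [← ih, ← sum_stepVec hd hreg (fun y => (transition d G ^ t) x y)]
    simp only [pow_succ, Matrix.mul_apply, stepVec]

lemma tvDist_succ_le (hd : 3 ≤ d) (hreg : G.IsRegularOfDegree d) (x : V) (t : ℕ) :
    tvDist d G x (t + 1) ≤ tvDist d G x t := by
  unfold tvDist
  refine mul_le_mul_of_nonneg_left ?_ (by norm_num)
  set c := 1 / (Fintype.card V : ℝ)
  calc ∑ y, |(transition d G ^ (t + 1)) x y - c|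
      = ∑ y, |∑ z, ((transition d G ^ t) x z - c) * transition d G z y| := by
        refine Finset.sum_congr rfl fun y _ => ?_
        have := congrFun (stepVec_const hd hreg c) y
        simp only [stepVec] at this
        rw [pow_succ, Matrix.mul_apply]
        simp only [sub_mul, Finset.sum_sub_distrib, this]
    _ ≤ ∑ y, ∑ z, |(transition d G ^ t) x z - c| * transition d G z y := by
        refine Finset.sum_le_sum fun y _ => (Finset.abs_sum_le_sum_abs _ _).trans_eq ?_
        refine Finset.sum_congr rfl fun z _ => ?_
        rw [abs_mul, abs_of_nonneg (transition_nonneg z y)]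
    _ = ∑ z, |(transition d G ^ t) x z - c| := sum_stepVec hd hreg _

lemma antitone_tvDist (hd : 3 ≤ d) (hreg : G.IsRegularOfDegree d) (x : V) :
    Antitone (tvDist d G x) :=
  antitone_nat_of_succ_le (tvDist_succ_le hd hreg x)

/-- Total variation is convex, so it is averaged over the mixture: lengths at most `r` contribute at
most `1`, the others at most `κ`. -/
lemma tvDist_le_of_nbLaw (hd : 3 ≤ d) (hreg : G.IsRegularOfDegree d) (x : V) (t : ℕ) {r κ : ℝ}
    (hκ0 : 0 ≤ κ)
    (hκ : ∀ k : ℕ, r < k →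
      (1 / 2) * ∑ y, |nbLaw d G x k y - 1 / (Fintype.card V : ℝ)| ≤ κ) :
    tvDist d G x t ≤ walkCdf (((d : ℝ) - 1) / d) t r + κ := by
  have hne : Nonempty V := ⟨x⟩
  have hcard : (0 : ℝ) < Fintype.card V := by exact_mod_cast Fintype.card_pos
  set c := 1 / (Fintype.card V : ℝ) with hc
  have hsum : ∑ _y : V, c = 1 := by simp [hc, hcard.ne']
  have h1 (y : V) : |(transition d G ^ t) x y - c|
      ≤ (radialStep d ^ t) (fun k => |nbLaw d G x k y - c|) 0 := by
    refine le_trans (le_of_eq ?_) (abs_radialStep_pow_le hd t _ 0)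
    have : (fun k => nbLaw d G x k y - c) = (fun k => nbLaw d G x k y) - fun _ => c := rfl
    rw [this, map_sub, radialStep_pow_const hd, Pi.sub_apply, radialStep_pow_nbLaw x hd hreg]
  calc tvDist d G x t
      ≤ (1 / 2) * ∑ y, (radialStep d ^ t) (fun k => |nbLaw d G x k y - c|) 0 := by
        unfold tvDist
        gcongr with y
        exact h1 y
    _ = (radialStep d ^ t) (fun k => (1 / 2) * ∑ y, |nbLaw d G x k y - c|) 0 := by
        have : (fun k => (1 / 2) * ∑ y, |nbLaw d G x k y - c|)
          = (1 / 2 : ℝ) • ∑ y, fun k => |nbLaw d G x k y - c| := by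
          ext k
          simp
        rw [this, map_smul, map_sum]
        simp
    _ ≤ (radialStep d ^ t) (ballInd r + fun _ => κ) 0 := by
        apply radialStep_pow_mono hd
        intro k
        simp only [Pi.add_apply, ballInd]
        split_ifs with hk
        · have : ∑ y, |nbLaw d G x k y - c| ≤ ∑ y, (nbLaw d G x k y + c) := by
            refine Finset.sum_le_sum fun y _ => abs_le.2 ⟨?_, ?_⟩
            · linarith [nbLaw_nonneg (G := G) x hd k y]
            · have : 0 ≤ c := by positivity
              linarith
          rw [Finset.sum_add_distrib, sum_nbLaw x hd hreg, hsum] at this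
          linarith
        · rw [zero_add]
          exact hκ k (not_le.1 hk)
    _ ≤ _ := by
        rw [map_add, radialStep_pow_const hd, Pi.add_apply]
        have := radialStep_pow_ballInd_le hd r t 0
        simp only [Nat.cast_zero, sub_zero] at this
        linarith

lemma one_le_nbLaw_mul (hd : 3 ≤ d) (x : V) (k : ℕ) {z : V} (h : nbLaw d G x k z ≠ 0) :
    1 ≤ nbLaw d G x k z * (d * ((d : ℝ) - 1) ^ k) := by
  have h3 : (3 : ℝ) ≤ d := by exact_mod_cast hd
  have h1 : (0 : ℝ) < d - 1 := by linarith
  have h2 : 1 ≤ (d : ℝ) - 1 := by linarith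
  cases k with
  | zero =>
    simp only [nbLaw] at h ⊢
    have : 1 ≤ nbCount G x 0 z := Nat.one_le_iff_ne_zero.2 (by exact_mod_cast h)
    have : (1 : ℝ) ≤ nbCount G x 0 z := by exact_mod_cast this
    simp only [pow_zero, mul_one]
    nlinarith
  | succ k =>
    simp only [nbLaw] at h ⊢
    have hne : nbCount G x (k + 1) z ≠ 0 := by
      intro h0
      simp [h0] at h
    have : (1 : ℝ) ≤ nbCount G x (k + 1) z := by exact_mod_cast Nat.one_le_iff_ne_zero.2 hne
    rw [pow_succ, ← mul_assoc (d : ℝ), ← mul_assoc, div_mul_cancel₀ _ (by positivity)]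
    nlinarith

lemma card_support_nbLaw_le (hd : 3 ≤ d) (hreg : G.IsRegularOfDegree d) (x : V) (k : ℕ) :
    ((Finset.univ.filter fun z => nbLaw d G x k z ≠ 0).card : ℝ) ≤ d * ((d : ℝ) - 1) ^ k := by
  have h3 : (3 : ℝ) ≤ d := by exact_mod_cast hd
  have h1 : (0 : ℝ) < d - 1 := by linarith
  calc ((Finset.univ.filter fun z => nbLaw d G x k z ≠ 0).card : ℝ)
      = ∑ z ∈ Finset.univ.filter fun z => nbLaw d G x k z ≠ 0, (1 : ℝ) := by simp
    _ ≤ ∑ z ∈ Finset.univ.filter fun z => nbLaw d G x k z ≠ 0,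
          nbLaw d G x k z * (d * ((d : ℝ) - 1) ^ k) := by
        refine Finset.sum_le_sum fun z hz => one_le_nbLaw_mul hd x k ?_
        simpa using hz
    _ ≤ ∑ z, nbLaw d G x k z * (d * ((d : ℝ) - 1) ^ k) := by
        refine Finset.sum_le_univ_sum_of_nonneg fun z => ?_
        have := nbLaw_nonneg (G := G) x hd k z
        positivity
    _ = _ := by rw [← Finset.sum_mul, sum_nbLaw x hd hreg, one_mul]

/-- The test set `B` is the union of the supports of `nbLaw k`, `k ≤ R`. It carries the walk
whenever the radius is at most `R`, yet has few vertices. -/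
lemma tvDist_ge (hd : 3 ≤ d) (hreg : G.IsRegularOfDegree d) (x : V) (t R : ℕ) :
    (radialStep d ^ t) (ballInd R) 0 - (R + 1) * (d * ((d : ℝ) - 1) ^ R) / Fintype.card V
      ≤ tvDist d G x t := by
  have h3 : (3 : ℝ) ≤ d := by exact_mod_cast hd
  have h2 : 1 ≤ (d : ℝ) - 1 := by linarith
  have hne : Nonempty V := ⟨x⟩
  have hcard : (0 : ℝ) < Fintype.card V := by exact_mod_cast Fintype.card_pos
  let B : Finset V := (Finset.range (R + 1)).biUnion
    fun k => Finset.univ.filter fun z => nbLaw d G x k z ≠ 0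
  have hB : (B.card : ℝ) ≤ (R + 1) * (d * ((d : ℝ) - 1) ^ R) := by
    calc (B.card : ℝ)
        ≤ ∑ k ∈ Finset.range (R + 1),
            ((Finset.univ.filter fun z => nbLaw d G x k z ≠ 0).card : ℝ) := by
          exact_mod_cast Finset.card_biUnion_le
      _ ≤ ∑ k ∈ Finset.range (R + 1), d * ((d : ℝ) - 1) ^ R := by
          refine Finset.sum_le_sum fun k hk => (card_support_nbLaw_le hd hreg x k).trans ?_
          have : k ≤ R := Nat.lt_succ_iff.1 (Finset.mem_range.1 hk)
          gcongr
      _ = _ := by simp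
  have hP : (radialStep d ^ t) (ballInd R) 0 ≤ ∑ z ∈ B, (transition d G ^ t) x z := by
    have : ∑ z ∈ B, (transition d G ^ t) x z
        = (radialStep d ^ t) (fun k => ∑ z ∈ B, nbLaw d G x k z) 0 := by
      have e : (fun k => ∑ z ∈ B, nbLaw d G x k z) = ∑ z ∈ B, fun k => nbLaw d G x k z := by
        ext k
        simp
      rw [e, map_sum, Finset.sum_apply]
      exact Finset.sum_congr rfl fun z _ => (radialStep_pow_nbLaw x hd hreg t z).symm
    rw [this]
    apply radialStep_pow_mono hd
    intro k
    simp only [ballInd]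
    split_ifs with hk
    · have hk' : k < R + 1 := Nat.lt_succ_iff.2 (by exact_mod_cast hk)
      rw [← sum_nbLaw x hd hreg k]
      refine le_of_eq (Finset.sum_subset (Finset.subset_univ B) fun z _ hz => ?_).symm
      by_contra hne
      exact hz (Finset.mem_biUnion.2 ⟨k, Finset.mem_range.2 hk', by simpa using hne⟩)
    · exact Finset.sum_nonneg fun z _ => nbLaw_nonneg x hd k z
  set c := 1 / (Fintype.card V : ℝ) with hc
  -- For a function of total sum zero, half the `ℓ¹` norm bounds the sum over any subset.
  have htv : ∑ z ∈ B, ((transition d G ^ t) x z - c) ≤ tvDist d G x t := by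
    have htot : ∑ z, ((transition d G ^ t) x z - c) = 0 := by
      rw [Finset.sum_sub_distrib, sum_transition_pow hd hreg]
      simp [hc, hcard.ne']
    have hsplit := Finset.sum_add_sum_compl B fun z => ((transition d G ^ t) x z - c)
    have hsplit' := Finset.sum_add_sum_compl B fun z => |(transition d G ^ t) x z - c|
    have a1 : ∑ z ∈ B, ((transition d G ^ t) x z - c) ≤ ∑ z ∈ B, |(transition d G ^ t) x z - c| :=
      Finset.sum_le_sum fun z _ => le_abs_self _
    have a2 : ∑ z ∈ Bᶜ, -((transition d G ^ t) x z - c)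
        ≤ ∑ z ∈ Bᶜ, |(transition d G ^ t) x z - c| :=
      Finset.sum_le_sum fun z _ => neg_le_abs _
    rw [Finset.sum_neg_distrib] at a2
    unfold tvDist
    linarith
  rw [Finset.sum_sub_distrib, Finset.sum_const, nsmul_eq_mul, hc, mul_one_div] at htv
  have : (B.card : ℝ) / Fintype.card V
      ≤ (R + 1) * (d * ((d : ℝ) - 1) ^ R) / Fintype.card V := by gcongr
  linarith

end TotalVariation

/-! ### Growth of spherical functions. -/

section Recurrence

/-- These are the roots of `X² - 2cX + 1`. They lie on the unit circle if `|c| ≤ 1`; otherwise they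
are real, of modulus at most `1 + η + 2√η ≤ 1 + 3√η`. -/
lemma exists_roots_of_abs_le {c η : ℝ} (h0 : 0 ≤ η) (h1 : η ≤ 1) (hc : |c| ≤ 1 + η) :
    ∃ ζ ξ : ℂ, ζ + ξ = 2 * c ∧ ζ * ξ = 1 ∧
      ‖ζ‖ ≤ Real.exp (3 * √η) ∧ ‖ξ‖ ≤ Real.exp (3 * √η) := by
  have hs0 := Real.sqrt_nonneg η
  have hs2 := Real.sq_sqrt h0
  have hexp := Real.add_one_le_exp (3 * √η)
  rcases le_or_gt |c| 1 with h | h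
  · have hc2 : c ^ 2 ≤ 1 := (sq_le_one_iff_abs_le_one c).2 h
    have hq : (√(1 - c ^ 2)) ^ 2 = 1 - c ^ 2 := Real.sq_sqrt (by linarith)
    have hq' : ((√(1 - c ^ 2) : ℝ) : ℂ) ^ 2 = 1 - c ^ 2 := by exact_mod_cast congrArg Complex.ofReal hq
    have hn (s : ℝ) (hs : s ^ 2 = 1 - c ^ 2) : ‖(c + s * Complex.I : ℂ)‖ ≤ Real.exp (3 * √η) := by
      rw [Complex.norm_add_mul_I, show c ^ 2 + s ^ 2 = 1 by linarith, Real.sqrt_one]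
      linarith
    refine ⟨c + (√(1 - c ^ 2) : ℝ) * Complex.I, c + (-√(1 - c ^ 2) : ℝ) * Complex.I, ?_, ?_,
      hn _ hq, hn _ (by rw [neg_sq, hq])⟩
    · push_cast
      ring
    · push_cast
      linear_combination hq' - ((√(1 - c ^ 2) : ℝ) : ℂ) ^ 2 * Complex.I_sq
  · have hc2 : 1 ≤ c ^ 2 := (one_le_sq_iff_one_le_abs c).2 h.le
    have hq : (√(c ^ 2 - 1)) ^ 2 = c ^ 2 - 1 := Real.sq_sqrt (by linarith)
    have hq' : ((√(c ^ 2 - 1) : ℝ) : ℂ) ^ 2 = c ^ 2 - 1 := by exact_mod_cast congrArg Complex.ofReal hq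
    have hq0 := Real.sqrt_nonneg (c ^ 2 - 1)
    have hqle : √(c ^ 2 - 1) ≤ 2 * √η := by
      apply Real.sqrt_le_iff.2 ⟨by positivity, ?_⟩
      have := sq_abs c
      nlinarith [abs_nonneg c]
    have hηs : η ≤ √η := by
      rw [Real.le_sqrt h0 h0]
      nlinarith
    have hn (s : ℝ) (hs : |s| = √(c ^ 2 - 1)) : ‖((c + s : ℝ) : ℂ)‖ ≤ Real.exp (3 * √η) := by
      rw [Complex.norm_real, Real.norm_eq_abs]
      linarith [abs_add_le c s]
    refine ⟨((c + √(c ^ 2 - 1) : ℝ) : ℂ), ((c + -√(c ^ 2 - 1) : ℝ) : ℂ), ?_, ?_,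
      hn _ (abs_of_nonneg hq0), hn _ (by rw [abs_neg, abs_of_nonneg hq0])⟩
    · push_cast
      ring
    · push_cast
      linear_combination -hq'

/-- Growth of solutions of the Chebyshev recurrence. -/
lemma abs_le_of_chebyshev_recurrence {c η : ℝ} (h0 : 0 ≤ η) (h1 : η ≤ 1) (hc : |c| ≤ 1 + η)
    {w : ℕ → ℝ} (hw1 : |w 1| ≤ 2 * |c| * |w 0|) (hw : ∀ k, w (k + 2) + w k = 2 * c * w (k + 1))
    (k : ℕ) : |w k| ≤ (1 + 3 * k) * Real.exp (3 * √η) ^ k * |w 0| := by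
  obtain ⟨ζ, ξ, hadd, hmul, hζ, hξ⟩ := exists_roots_of_abs_le h0 h1 hc
  set r := Real.exp (3 * √η)
  have hr1 : 1 ≤ r := Real.one_le_exp (by positivity)
  have hc2 : 2 * |c| ≤ 2 * r := by
    have : ‖(2 * c : ℂ)‖ = 2 * |c| := by simp
    rw [← this, ← hadd]
    linarith [norm_add_le ζ ξ]
  have hw' (k : ℕ) : (w (k + 2) : ℂ) + w k = 2 * c * w (k + 1) := by exact_mod_cast hw k
  have hδ0 : ‖(w 1 : ℂ) - ζ * w 0‖ ≤ 3 * r * |w 0| := by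
    refine (norm_sub_le _ _).trans ?_
    rw [norm_mul, Complex.norm_real, Complex.norm_real, Real.norm_eq_abs, Real.norm_eq_abs]
    nlinarith [abs_nonneg (w 0)]
  -- Factoring the recurrence makes this difference geometric of ratio `ξ`. Nothing is divided by `ζ
  -- - ξ`, so a double root is allowed; it is why a factor linear in `k` appears.
  have hδ (k : ℕ) : ‖(w (k + 1) : ℂ) - ζ * w k‖ ≤ r ^ k * (3 * r * |w 0|) := by
    induction k with
    | zero => simpa using hδ0
    | succ k ih =>
      have : (w (k + 1 + 1) : ℂ) - ζ * w (k + 1) = ξ * (w (k + 1) - ζ * w k) := by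
        linear_combination hw' k - w (k + 1) * hadd + w k * hmul
      rw [this, norm_mul, pow_succ, mul_comm (r ^ k), mul_assoc]
      gcongr
  induction k with
  | zero => simp
  | succ k ih =>
    have e : |w (k + 1)| = ‖((w (k + 1) : ℂ) - ζ * w k) + ζ * w k‖ := by
      rw [sub_add_cancel, Complex.norm_real, Real.norm_eq_abs]
    rw [e]
    refine (norm_add_le _ _).trans ?_
    rw [norm_mul, Complex.norm_real, Real.norm_eq_abs]
    calc _ ≤ r ^ k * (3 * r * |w 0|) + r * ((1 + 3 * k) * r ^ k * |w 0|) := by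
          gcongr
          exact hδ k
      _ = _ := by
          push_cast
          ring

/-- Growth of the spherical functions of the `d`-regular tree. -/
lemma abs_le_of_spherical_recurrence {d : ℕ} (hd : 3 ≤ d) {μ η : ℝ} (h0 : 0 ≤ η) (h1 : η ≤ 1)
    (hμ : d * |μ| / (2 * √((d : ℝ) - 1)) ≤ 1 + η) {u : ℕ → ℝ} (hu1 : u 1 = μ * u 0)
    (hu : ∀ k, μ * u (k + 1) = 1 / d * u k + (d - 1) / d * u (k + 2)) (k : ℕ) :
    |u k| ≤ (1 + 3 * k) * Real.exp (3 * √η) ^ k / √((d : ℝ) - 1) ^ k * |u 0| := by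
  have h3 : (3 : ℝ) ≤ d := by exact_mod_cast hd
  set s := √((d : ℝ) - 1) with hs
  have hs0 : 0 < s := Real.sqrt_pos.2 (by linarith)
  have hs2 : s ^ 2 = d - 1 := Real.sq_sqrt (by linarith)
  have hd0 : (0 : ℝ) < d := by linarith
  have hc : |d * μ / (2 * s)| = d * |μ| / (2 * s) := by
    rw [abs_div, abs_mul, abs_of_pos hd0, abs_of_pos (show 0 < 2 * s by positivity)]
  -- Rescaling by `s^k`, with `s² = d - 1`, balances the two coefficients and yields the Chebyshev
  -- recurrence.
  have key := abs_le_of_chebyshev_recurrence (c := d * μ / (2 * s)) (w := fun k => s ^ k * u k)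
    h0 h1 (hc.trans_le hμ) ?_ ?_ k
  · rw [abs_mul, abs_of_pos (pow_pos hs0 k), pow_zero, one_mul] at key
    rw [div_mul_eq_mul_div, le_div_iff₀ (pow_pos hs0 k)]
    linarith
  · rw [hc]
    simp only [pow_one, pow_zero, one_mul]
    rw [hu1, abs_mul, abs_mul, abs_of_pos hs0, ← mul_assoc]
    refine mul_le_mul_of_nonneg_right ?_ (abs_nonneg _)
    have : s * s ≤ d := by nlinarith
    rw [show 2 * (d * |μ| / (2 * s)) = d * |μ| / s by field_simp, le_div_iff₀ hs0]
    nlinarith [abs_nonneg μ]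
  · intro k
    have := hu k
    field_simp at this
    have e : s ^ (k + 2) = s ^ k * (d - 1) := by rw [pow_add, hs2]
    simp only [e, pow_succ]
    field_simp
    linear_combination -this

end Recurrence

/-! ### Spectral estimate for nonbacktracking walks. -/

section Spectral

variable {V : Type*} [Fintype V] [DecidableEq V] {d : ℕ} {G : SimpleGraph V} [DecidableRel G.Adj]

lemma exists_eigenbasis_of_isHermitian {A : Matrix V V ℝ} (hA : A.IsHermitian) :
    ∃ (b : V → V → ℝ) (μ : V → ℝ), (∀ i, b i ≠ 0) ∧ (∀ i, A.mulVec (b i) = μ i • b i) ∧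
      ∀ f : V → ℝ, ∑ i, (∑ z, b i z * f z) ^ 2 = ∑ z, f z ^ 2 := by
  refine ⟨fun i => (hA.eigenvectorBasis i).ofLp, hA.eigenvalues, fun i h => ?_,
    hA.mulVec_eigenvectorBasis, fun f => ?_⟩
  · have h1 := hA.eigenvectorBasis.orthonormal.1 i
    have : hA.eigenvectorBasis i = 0 := by
      ext z
      exact congrFun h z
    rw [this] at h1
    simp at h1
  · have h := hA.eigenvectorBasis.sum_sq_inner_right (WithLp.toLp 2 f)
    rw [EuclideanSpace.real_norm_sq_eq] at h
    simpa [PiLp.inner_apply, mul_comm] using h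

lemma abs_le_one_of_transition_mulVec (hd : 3 ≤ d) (hreg : G.IsRegularOfDegree d) {μ : ℝ}
    {f : V → ℝ} (hf : f ≠ 0) (h : (transition d G).mulVec f = μ • f) : |μ| ≤ 1 := by
  obtain ⟨y, hy⟩ := Function.ne_iff.1 hf
  have hne : Nonempty V := ⟨y⟩
  obtain ⟨x, hx⟩ := Finite.exists_max fun x => |f x|
  have hpos : 0 < |f x| := (abs_pos.2 hy).trans_le (hx y)
  have h1 : |μ| * |f x| ≤ 1 * |f x| := by
    have e : ∑ z, transition d G x z * f z = μ * f x := congrFun h x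
    rw [← abs_mul, ← e, ← sum_transition hd hreg x, Finset.sum_mul]
    refine (Finset.abs_sum_le_sum_abs _ _).trans (Finset.sum_le_sum fun z _ => ?_)
    rw [abs_mul, abs_of_nonneg (transition_nonneg x z)]
    exact mul_le_mul_of_nonneg_left (hx z) (transition_nonneg x z)
  exact le_of_mul_le_mul_right h1 hpos

lemma abs_le_spectralRadius₀ (hd : 3 ≤ d) (hreg : G.IsRegularOfDegree d) {μ : ℝ}
    {f : V → ℝ} (hf : f ≠ 0) (hsum : ∑ x, f x = 0) (h : (transition d G).mulVec f = μ • f) :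
    |μ| ≤ spectralRadius₀ d G := by
  -- The real `sSup` is meaningful only for a bounded set; `1` bounds every eigenvalue.
  refine le_csSup ⟨1, ?_⟩ ⟨μ, f, hf, hsum, h, rfl⟩
  rintro r ⟨ν, g, hg, -, hg', rfl⟩
  exact abs_le_one_of_transition_mulVec hd hreg hg hg'

lemma transition_mulVec_const (hd : 3 ≤ d) (hreg : G.IsRegularOfDegree d) (c : ℝ) :
    (transition d G).mulVec (fun _ => c) = fun _ => c := by
  ext y
  simp only [Matrix.mulVec, dotProduct]
  rw [← Finset.sum_mul, sum_transition hd hreg, one_mul]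

lemma sum_mul_stepVec {μ : ℝ} {b : V → ℝ} (hb : (transition d G).mulVec b = μ • b) (f : V → ℝ) :
    ∑ z, b z * stepVec d G f z = μ * ∑ z, b z * f z := by
  have e (y : V) : ∑ z, transition d G y z * b z = μ * b y := congrFun hb y
  simp only [stepVec, Finset.mul_sum]
  rw [Finset.sum_comm]
  refine Finset.sum_congr rfl fun y _ => ?_
  rw [← mul_assoc, ← e, Finset.sum_mul]
  refine Finset.sum_congr rfl fun z _ => ?_
  ring

/-- An eigenvector of `P` is constant, or its eigenvalue is at most the spectral radius on
functions with zero sum. -/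
lemma eigenvector_const_or_abs_le (hd : 3 ≤ d) (hreg : G.IsRegularOfDegree d) {μ : ℝ} {b : V → ℝ}
    (hb0 : b ≠ 0) (hb : (transition d G).mulVec b = μ • b) :
    (∃ m, b = fun _ => m) ∨ |μ| ≤ spectralRadius₀ d G := by
  obtain ⟨y, -⟩ := Function.ne_iff.1 hb0
  have hne : Nonempty V := ⟨y⟩
  have hcard : (0 : ℝ) < Fintype.card V := by exact_mod_cast Fintype.card_pos
  -- The eigenbasis need not contain the constants. For `μ = 1` the mean is subtracted; for `μ ≠ 1`
  -- symmetry of `P` forces zero sum.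
  by_cases hμ : μ = 1
  · set m := (∑ z, b z) / Fintype.card V with hm
    by_cases hbm : b - (fun _ => m) = 0
    · exact Or.inl ⟨m, sub_eq_zero.1 hbm⟩
    · refine Or.inr (abs_le_spectralRadius₀ hd hreg hbm ?_ ?_)
      · simp [hm]
        field_simp
        simp
      · rw [Matrix.mulVec_sub, hb, transition_mulVec_const hd hreg, hμ, one_smul, one_smul]
  · refine Or.inr (abs_le_spectralRadius₀ hd hreg hb0 ?_ hb)
    have h := sum_mul_stepVec hb (fun _ => 1)
    rw [stepVec_const hd hreg] at h
    simp only [mul_one] at h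
    have : (1 - μ) * ∑ z, b z = 0 := by linarith
    exact (mul_eq_zero.1 this).resolve_left (sub_ne_zero.2 (Ne.symm hμ))

lemma stepVec_sub (f g : V → ℝ) : stepVec d G (f - g) = stepVec d G f - stepVec d G g := by
  ext z
  simp [stepVec, sub_mul]

/-- Along an eigenvector a step of `P` is multiplication by `μ`, so the coefficients of `nbLaw k -
1/n` satisfy the spherical recurrence in `k`. Parseval sums the bounds, starting from squared norm
`1 - 1/n`. -/
lemma sum_sq_nbLaw_sub_le (hd : 3 ≤ d) (hreg : G.IsRegularOfDegree d)
    (hη : ramanujanDefect d G ≤ 1) (x : V) (k : ℕ) :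
    ∑ z, (nbLaw d G x k z - 1 / (Fintype.card V : ℝ)) ^ 2
      ≤ ((1 + 3 * k) * Real.exp (3 * √(ramanujanDefect d G)) ^ k / √((d : ℝ) - 1) ^ k) ^ 2 := by
  have h3 : (3 : ℝ) ≤ d := by exact_mod_cast hd
  have hne : Nonempty V := ⟨x⟩
  have hcard : (1 : ℝ) ≤ Fintype.card V := by exact_mod_cast Fintype.card_pos
  set c := 1 / (Fintype.card V : ℝ) with hcdef
  set η := ramanujanDefect d G with hηdef
  have h0 : 0 ≤ η := le_max_left _ _
  let v : ℕ → V → ℝ := fun k => nbLaw d G x k - fun _ => c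
  have hstep (k : ℕ) : stepVec d G (v k) = stepVec d G (nbLaw d G x k) - fun _ => c := by
    rw [stepVec_sub, stepVec_const hd hreg]
  have hv0 (k : ℕ) : ∑ z, v k z = 0 := by
    simp only [v, Pi.sub_apply, Finset.sum_sub_distrib, sum_nbLaw x hd hreg]
    simp [hcdef]
  obtain ⟨b, μ, hb0, hb, hparseval⟩ := exists_eigenbasis_of_isHermitian (A := transition d G)
    (Matrix.IsHermitian.ext fun y z => by simp [transition_symm y z])
  set β := (1 + 3 * k) * Real.exp (3 * √η) ^ k / √((d : ℝ) - 1) ^ k with hβ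
  have hβ0 : 0 ≤ β := by positivity
  have hcoef (i : V) : |∑ z, b i z * v k z| ≤ β * |∑ z, b i z * v 0 z| := by
    rcases eigenvector_const_or_abs_le hd hreg (hb0 i) (hb i) with ⟨m, hm⟩ | hμ
    · rw [hm, ← Finset.mul_sum, hv0, mul_zero, abs_zero]
      positivity
    · refine abs_le_of_spherical_recurrence hd h0 hη (μ := μ i) ?_
        (u := fun k => ∑ z, b i z * v k z) ?_ ?_ k
      · have : (d : ℝ) * spectralRadius₀ d G / (2 * √((d : ℝ) - 1)) - 1 ≤ η := le_max_right _ _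
        refine le_trans ?_ (show (d : ℝ) * spectralRadius₀ d G / (2 * √((d : ℝ) - 1)) ≤ 1 + η by
          linarith)
        gcongr
      · rw [← sum_mul_stepVec (hb i), hstep, stepVec_nbLaw_zero]
      · intro k
        rw [← sum_mul_stepVec (hb i), hstep, Finset.mul_sum, Finset.mul_sum,
          ← Finset.sum_add_distrib]
        refine Finset.sum_congr rfl fun z _ => ?_
        simp only [v, Pi.sub_apply, stepVec_nbLaw_succ x hd hreg]
        field_simp
        ring
  have hinit : ∑ z, v 0 z ^ 2 ≤ 1 := by
    have e (z : V) : v 0 z ^ 2 = (1 - 2 * c) * nbLaw d G x 0 z + c ^ 2 := by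
      simp only [v, Pi.sub_apply, nbLaw, nbCount]
      split_ifs <;> push_cast <;> ring
    simp only [e, Finset.sum_add_distrib, ← Finset.mul_sum, sum_nbLaw x hd hreg]
    simp only [Finset.sum_const, Finset.card_univ, nsmul_eq_mul]
    have hc1 : (Fintype.card V : ℝ) * c = 1 := by simp [hcdef]
    have hc0 : 0 ≤ c := by positivity
    nlinarith
  calc ∑ z, (nbLaw d G x k z - c) ^ 2 = ∑ i, (∑ z, b i z * v k z) ^ 2 := by
        rw [hparseval]
        rfl
    _ ≤ ∑ i, β ^ 2 * (∑ z, b i z * v 0 z) ^ 2 := by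
        refine Finset.sum_le_sum fun i _ => ?_
        rw [← sq_abs, ← sq_abs (∑ z, b i z * v 0 z), ← mul_pow]
        exact pow_le_pow_left₀ (abs_nonneg _) (hcoef i) 2
    _ ≤ β ^ 2 := by
        rw [← Finset.mul_sum, hparseval]
        nlinarith [sq_nonneg β]

/-- Total variation bound for the nonbacktracking walk. -/
lemma half_sum_abs_nbLaw_sub_le (hd : 3 ≤ d) (hreg : G.IsRegularOfDegree d)
    (hη : ramanujanDefect d G ≤ 1) (x : V) (k : ℕ) :
    (1 / 2) * ∑ y, |nbLaw d G x k y - 1 / (Fintype.card V : ℝ)|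
      ≤ √(Fintype.card V) *
        ((1 + 3 * k) * Real.exp (3 * √(ramanujanDefect d G)) ^ k / √((d : ℝ) - 1) ^ k) := by
  have h := sum_sq_nbLaw_sub_le hd hreg hη x k
  set β := (1 + 3 * k) * Real.exp (3 * √(ramanujanDefect d G)) ^ k / √((d : ℝ) - 1) ^ k
  have hβ0 : 0 ≤ β := by positivity
  set f : V → ℝ := fun y => nbLaw d G x k y - 1 / (Fintype.card V : ℝ) with hf
  have hcs : (∑ y, |f y|) ^ 2 ≤ Fintype.card V * ∑ y, |f y| ^ 2 := by
    simpa using sq_sum_le_card_mul_sum_sq (s := Finset.univ) (f := fun y => |f y|)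
  simp only [sq_abs] at hcs
  have h2 : ∑ y, |f y| ≤ √(Fintype.card V) * β := by
    refine (sq_le_sq₀ (Finset.sum_nonneg fun y _ => abs_nonneg _) (by positivity)).1 ?_
    rw [mul_pow, Real.sq_sqrt (by positivity)]
    exact hcs.trans (by gcongr)
  have h4 : 0 ≤ ∑ y, |f y| := Finset.sum_nonneg fun y _ => abs_nonneg _
  linarith

end Spectral

/-! ### From total variation to mixing times. -/

section MixingTime

variable {V : Type*} [Fintype V] [DecidableEq V] {d : ℕ} {G : SimpleGraph V} [DecidableRel G.Adj]

lemma mixingTime_le {ε : ℝ} {t : ℕ} (h : ∀ x, tvDist d G x t < ε) : mixingTime d G ε ≤ t :=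
  iSup_le fun x => iInf₂_le t (h x)

lemma antitone_mixingTime : Antitone (mixingTime d G) := fun _ _ h =>
  iSup_mono fun _ => le_iInf₂ fun t ht => iInf₂_le t (ht.trans_le h)

lemma add_one_le_mixingTime (hd : 3 ≤ d) (hreg : G.IsRegularOfDegree d) {ε : ℝ} {t : ℕ} {x : V}
    (h : ε ≤ tvDist d G x t) : ((t + 1 : ℕ) : ℕ∞) ≤ mixingTime d G ε := by
  refine le_trans (le_iInf₂ fun t' ht' => ?_) (le_iSup (fun x => mixingTimeFrom d G x ε) x)
  refine Nat.cast_le.2 (Nat.succ_le_of_lt ?_)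
  by_contra hle
  exact absurd (h.trans (antitone_tvDist hd hreg x (not_lt.1 hle))) (not_le.2 ht')

end MixingTime

/-! ### Gaussian profile. -/

section Gaussian

lemma gaussianTail_eq_cdf_neg (d : ℕ) (x : ℝ) :
    gaussianTail d x = cdf (gaussianReal 0 1) (-(profileConst d * x)) := by
  have h : (gaussianReal 0 1).map (fun y => -y) = gaussianReal 0 1 := by
    simpa using gaussianReal_map_neg (μ := 0) (v := 1)
  rw [gaussianTail, cdf_eq_real, ← h, MeasureTheory.map_measureReal_apply measurable_neg
    measurableSet_Iic, h]
  congr 1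
  ext y
  simp

variable {d : ℕ}

lemma log_pos_of_three_le (hd : 3 ≤ d) : 0 < Real.log ((d : ℝ) - 1) := by
  have h3 : (3 : ℝ) ≤ d := by exact_mod_cast hd
  exact Real.log_pos (by linarith)

/-- The constant is drift over (standard deviation of a step times `√c`), where `c log n` is the
leading order of the mixing time: the form delivered by the central limit theorem. -/
lemma profileConst_eq (hd : 3 ≤ d) :
    profileConst d = (((d : ℝ) - 2) / d) / (√(4 * (((d : ℝ) - 1) / d) * (1 - ((d : ℝ) - 1) / d))
      * √((d : ℝ) / (((d : ℝ) - 2) * Real.log ((d : ℝ) - 1)))) := by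
  have h3 : (3 : ℝ) ≤ d := by exact_mod_cast hd
  have hL := log_pos_of_three_le hd
  have h0 : (0 : ℝ) < d := by linarith
  have h1 : (0 : ℝ) < d - 1 := by linarith
  have h2 : (0 : ℝ) < d - 2 := by linarith
  have e : 1 - ((d : ℝ) - 1) / d = 1 / d := by field_simp; ring
  rw [e]
  refine (sq_eq_sq₀ (profileConst_pos hd).le (by positivity)).1 ?_
  unfold profileConst
  rw [div_pow, mul_pow, mul_pow, div_pow _ (_ * _), mul_pow, Real.sq_sqrt hL.le,
    Real.sq_sqrt (by positivity), Real.sq_sqrt (by positivity), Real.sq_sqrt (by positivity),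
    ← Real.rpow_natCast, ← Real.rpow_mul h2.le]
  norm_num
  field_simp

/-- Central limit theorem at the scale of the mixing time. -/
lemma tendsto_walkCdf_gaussianTail (hd : 3 ≤ d) {ι : Type*} {l : Filter ι} {ℓ : ι → ℝ}
    (hℓ : Tendsto ℓ l atTop) {t : ι → ℕ} {r : ι → ℝ} {x : ℝ}
    (ht : Tendsto (fun i => (t i : ℝ) / ℓ i) l
      (𝓝 ((d : ℝ) / (((d : ℝ) - 2) * Real.log ((d : ℝ) - 1)))))
    (hr : Tendsto (fun i => (r i - ((d : ℝ) - 2) / d * t i) / √(ℓ i)) l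
      (𝓝 (-(((d : ℝ) - 2) / d * x)))) :
    Tendsto (fun i => walkCdf (((d : ℝ) - 1) / d) (t i) (r i)) l (𝓝 (gaussianTail d x)) := by
  have h3 : (3 : ℝ) ≤ d := by exact_mod_cast hd
  have hL := log_pos_of_three_le hd
  have h2 : (0 : ℝ) < d - 2 := by linarith
  obtain ⟨p0, p1⟩ := prob_pos_lt hd
  set c := (d : ℝ) / (((d : ℝ) - 2) * Real.log ((d : ℝ) - 1)) with hc
  have hc0 : 0 < c := by positivity
  have hpos : ∀ᶠ i in l, 0 < ℓ i := hℓ.eventually_gt_atTop 0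
  have htop : Tendsto t l atTop := by
    rw [← tendsto_natCast_atTop_iff (R := ℝ)]
    refine (ht.pos_mul_atTop hc0 hℓ).congr' ?_
    filter_upwards [hpos] with i hi
    exact div_mul_cancel₀ _ hi.ne'
  rw [gaussianTail_eq_cdf_neg]
  refine tendsto_walkCdf p0 p1 htop ?_
  have hσ : 0 < √(4 * (((d : ℝ) - 1) / d) * (1 - ((d : ℝ) - 1) / d)) :=
    Real.sqrt_pos.2 (mul_pos (by linarith) (by linarith))
  have hsc : 0 < √c := Real.sqrt_pos.2 hc0
  rw [profileConst_eq hd]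
  have := hr.div (tendsto_const_nhds.mul ht.sqrt) (mul_pos hσ hsc).ne'
  convert this.congr' ?_ using 2
  · rw [← hc, div_mul_eq_mul_div, neg_div]
  · filter_upwards [hpos, htop.eventually_gt_atTop 0] with i hi hti
    have e : 2 * (((d : ℝ) - 1) / d) - 1 = ((d : ℝ) - 2) / d := by field_simp; ring
    have hs := Real.sqrt_pos.2 hi
    have hs' : 0 < √(t i : ℝ) := Real.sqrt_pos.2 (by exact_mod_cast hti)
    rw [Pi.div_apply, e, Real.sqrt_div' _ hi.le, mul_comm (((d : ℝ) - 2) / d) (t i : ℝ)]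
    field_simp

end Gaussian

/-! ### Elementary limits and diagonal extraction. -/

section Asymptotics

variable {ι : Type*} {l : Filter ι}

lemma tendsto_pow_mul_exp_neg (n : ℕ) {b : ℝ} (hb : 0 < b) :
    Tendsto (fun g : ℝ => g ^ n * Real.exp (-b * g)) atTop (𝓝 0) := by
  refine (isLittleO_pow_exp_pos_mul_atTop n hb).tendsto_div_nhds_zero.congr fun g => ?_
  rw [neg_mul, Real.exp_neg, div_eq_mul_inv]

lemma tendsto_quartic_mul_exp_neg (a₀ a₁ a₄ : ℝ) {b : ℝ} (hb : 0 < b) :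
    Tendsto (fun g : ℝ => (a₀ + a₁ * g + a₄ * g ^ 4) * Real.exp (-b * g)) atTop (𝓝 0) := by
  have h := (((tendsto_pow_mul_exp_neg 0 hb).const_mul a₀).add
    ((tendsto_pow_mul_exp_neg 1 hb).const_mul a₁)).add
    ((tendsto_pow_mul_exp_neg 4 hb).const_mul a₄)
  simp only [mul_zero, add_zero] at h
  refine h.congr fun g => ?_
  ring

lemma tendsto_sqrt_atTop' {ℓ : ι → ℝ} (hℓ : Tendsto ℓ l atTop) :
    Tendsto (fun i => √(ℓ i)) l atTop :=
  Real.tendsto_sqrt_atTop.comp hℓ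

lemma tendsto_sub_floor_div_sqrt {ℓ a : ι → ℝ} (hℓ : Tendsto ℓ l atTop)
    (ha : ∀ᶠ i in l, 0 ≤ a i) : Tendsto (fun i => (a i - ⌊a i⌋₊) / √(ℓ i)) l (𝓝 0) := by
  have h : Tendsto (fun i => 1 / √(ℓ i)) l (𝓝 0) :=
    tendsto_const_nhds.div_atTop (tendsto_sqrt_atTop' hℓ)
  refine tendsto_of_tendsto_of_tendsto_of_le_of_le' tendsto_const_nhds h ?_ ?_
  · filter_upwards [ha] with i hi
    exact div_nonneg (sub_nonneg.2 (Nat.floor_le hi)) (Real.sqrt_nonneg _)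
  · filter_upwards with i
    have := (Nat.lt_floor_add_one (a i)).le
    gcongr
    linarith

lemma tendsto_quarter_div_sqrt {ℓ : ι → ℝ} (hℓ : Tendsto ℓ l atTop) :
    Tendsto (fun i => √√(ℓ i) / √(ℓ i)) l (𝓝 0) := by
  have h : Tendsto (fun i => 1 / √√(ℓ i)) l (𝓝 0) :=
    tendsto_const_nhds.div_atTop (tendsto_sqrt_atTop' (tendsto_sqrt_atTop' hℓ))
  refine h.congr fun i => ?_
  rw [Real.sqrt_div_self']

lemma tendsto_affine_sqrt_div {ℓ e : ι → ℝ} (hℓ : Tendsto ℓ l atTop) {c : ℝ}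
    (he : Tendsto e l (𝓝 0)) (s : ℝ) :
    Tendsto (fun i => ((c + e i) * ℓ i + s * √(ℓ i)) / ℓ i) l (𝓝 c) := by
  have h : Tendsto (fun i => s / √(ℓ i)) l (𝓝 0) :=
    tendsto_const_nhds.div_atTop (tendsto_sqrt_atTop' hℓ)
  have h' := (he.const_add c).add h
  rw [add_zero, add_zero] at h'
  refine h'.congr' ?_
  filter_upwards [hℓ.eventually_gt_atTop 0] with i hi
  rw [add_div, mul_div_cancel_right₀ _ hi.ne', mul_div_assoc, Real.sqrt_div_self', mul_one_div]

lemma eventually_affine_sqrt_pos {ℓ e : ι → ℝ} (hℓ : Tendsto ℓ l atTop) {c : ℝ} (hc : 0 < c)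
    (he : Tendsto e l (𝓝 0)) (s : ℝ) : ∀ᶠ i in l, 0 < (c + e i) * ℓ i + s * √(ℓ i) := by
  filter_upwards [(tendsto_affine_sqrt_div hℓ he s).eventually (eventually_gt_nhds hc),
    hℓ.eventually_gt_atTop 0] with i hi hi'
  exact (div_pos_iff_of_pos_right hi').1 hi

lemma tendsto_floor_affine_sqrt_div {ℓ e : ι → ℝ} (hℓ : Tendsto ℓ l atTop) {c : ℝ} (hc : 0 < c)
    (he : Tendsto e l (𝓝 0)) (s : ℝ) :
    Tendsto (fun i => (⌊(c + e i) * ℓ i + s * √(ℓ i)⌋₊ : ℝ) / ℓ i) l (𝓝 c) := by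
  have h1 := tendsto_sub_floor_div_sqrt hℓ
    ((eventually_affine_sqrt_pos hℓ hc he s).mono fun _ h => h.le)
  have h2 : Tendsto (fun i => 1 / √(ℓ i)) l (𝓝 0) :=
    tendsto_const_nhds.div_atTop (tendsto_sqrt_atTop' hℓ)
  have h3 := (tendsto_affine_sqrt_div hℓ he s (c := c)).sub (h1.mul h2)
  rw [mul_zero, sub_zero] at h3
  refine h3.congr' ?_
  filter_upwards [hℓ.eventually_gt_atTop 0] with i hi
  rw [div_mul_div_comm, Real.mul_self_sqrt hi.le, mul_one, ← sub_div, sub_sub_cancel]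

/-- Diagonal argument: `φ i` is the largest `m ≤ N i` for which `p m i` holds, the cap `N i` making
it finite. -/
lemma exists_tendsto_atTop_of_forall_eventually {N : ι → ℕ} (hN : Tendsto N l atTop)
    {p : ℕ → ι → Prop} (hp : ∀ m, ∀ᶠ i in l, p m i) :
    ∃ φ : ι → ℕ, Tendsto φ l atTop ∧ ∀ᶠ i in l, p (φ i) i := by
  classical
  refine ⟨fun i => Nat.findGreatest (p · i) (N i), tendsto_atTop.2 fun m => ?_, ?_⟩
  · filter_upwards [hp m, hN.eventually_ge_atTop m] with i hi hm
    exact Nat.le_findGreatest hm hi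
  · filter_upwards [hp 0] with i hi
    exact Nat.findGreatest_spec (P := (p · i)) (Nat.zero_le _) hi

end Asymptotics

/-! ### Mixing time asymptotics. -/

section Main

variable {ι : Type*} {l : Filter ι} {V : ι → Type*} [∀ i, Fintype (V i)] [∀ i, DecidableEq (V i)]
  {G : ∀ i, SimpleGraph (V i)} [∀ i, DecidableRel (G i).Adj] {d : ℕ}

lemma tendsto_log_card (hN : Tendsto (fun i => Fintype.card (V i)) l atTop) :
    Tendsto (fun i => Real.log (Fintype.card (V i))) l atTop :=
  Real.tendsto_log_atTop.comp (tendsto_natCast_atTop_atTop.comp hN)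

/-- Used with `L = log (d-1)`, `e = √η`, `ℓ = log n`, `g = ℓ^(1/4)`. The slack `12/L² · e` in `r`
outweighs the loss `3e` in the rate as soon as `12e ≤ L`. The rate is then at least `L/4`, so the
excess `k - r` absorbs its own linear factor and the bound is uniform in `k`. -/
lemma spectral_exponent_le {L e ℓ g r k : ℝ} (hL : 0 < L) (he0 : 0 ≤ e) (he : 12 / L * e ≤ 1)
    (hg : 0 ≤ g) (hℓ : 0 ≤ ℓ) (hr : r = (1 / L + 12 / L / L * e) * ℓ + g)
    (hk : r < k) :
    (1 + 3 * k) * Real.exp (ℓ / 2 - (L / 2 - 3 * e) * k)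
      ≤ (1 + 3 * (2 / L * ℓ + g)) * (1 + 12 / L) * Real.exp (-(L / 4) * g) := by
  obtain ⟨j, rfl⟩ : ∃ j, k = r + j := ⟨k - r, by ring⟩
  have hj : 0 < j := by linarith
  have he' : 12 * e ≤ L := by
    rw [div_mul_eq_mul_div, div_le_one hL] at he
    exact he
  have hr2 : r ≤ 2 / L * ℓ + g := by
    rw [hr]
    have : 12 / L / L * e ≤ 1 / L := by
      rw [div_mul_eq_mul_div, div_le_div_iff_of_pos_right hL]
      exact he
    have : 1 / L + 12 / L / L * e ≤ 2 / L := by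
      rw [show 2 / L = 1 / L + 1 / L by ring]
      linarith
    gcongr
  have hr0 : 0 ≤ r := by rw [hr]; positivity
  have hβ : ℓ / 2 + L / 4 * g ≤ (L / 2 - 3 * e) * r := by
    have h1 : (L / 2 - 3 * e) * (1 / L + 12 / L / L * e) = 1 / 2 + 3 * e * (L - 12 * e) / L ^ 2 := by
      field_simp
      ring
    have h2 : 0 ≤ 3 * e * (L - 12 * e) / L ^ 2 :=
      div_nonneg (mul_nonneg (by linarith) (by linarith)) (by positivity)
    rw [hr, mul_add, ← mul_assoc, h1]
    have h3 : L / 4 * g ≤ (L / 2 - 3 * e) * g := mul_le_mul_of_nonneg_right (by linarith) hg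
    nlinarith
  have hexp : Real.exp (ℓ / 2 - (L / 2 - 3 * e) * (r + j))
      ≤ Real.exp (-(L / 4) * g) * Real.exp (-(L / 4 * j)) := by
    rw [← Real.exp_add]
    apply Real.exp_le_exp.2
    have : L / 4 * j ≤ (L / 2 - 3 * e) * j := mul_le_mul_of_nonneg_right (by linarith) hj.le
    linarith
  have hlin : 1 + 3 * j ≤ (1 + 12 / L) * Real.exp (L / 4 * j) := by
    have h1 := Real.add_one_le_exp (L / 4 * j)
    have h2 : 0 < L / 4 * j := by positivity
    have h3 : 12 / L * (L / 4 * j) ≤ 12 / L * Real.exp (L / 4 * j) := by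
      gcongr
      linarith
    have h4 : 12 / L * (L / 4 * j) = 3 * j := by field_simp; ring
    rw [add_mul]
    linarith
  calc (1 + 3 * (r + j)) * Real.exp (ℓ / 2 - (L / 2 - 3 * e) * (r + j))
      ≤ ((1 + 3 * r) * (1 + 3 * j)) * (Real.exp (-(L / 4) * g) * Real.exp (-(L / 4 * j))) := by
        gcongr
        nlinarith
    _ ≤ ((1 + 3 * r) * ((1 + 12 / L) * Real.exp (L / 4 * j)))
          * (Real.exp (-(L / 4) * g) * Real.exp (-(L / 4 * j))) := by gcongr
    _ = (1 + 3 * r) * (1 + 12 / L) * Real.exp (-(L / 4) * g)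
          * (Real.exp (L / 4 * j) * Real.exp (-(L / 4 * j))) := by ring
    _ = (1 + 3 * r) * (1 + 12 / L) * Real.exp (-(L / 4) * g) := by
        rw [← Real.exp_add, add_neg_cancel, Real.exp_zero, mul_one]
    _ ≤ _ := by gcongr

/-- Beyond the entropic radius the nonbacktracking walks are close to equilibrium. -/
lemma eventually_nbLaw_close (hd : 3 ≤ d) (hreg : ∀ i, (G i).IsRegularOfDegree d)
    (hN : Tendsto (fun i => Fintype.card (V i)) l atTop)
    (hη : Tendsto (fun i => ramanujanDefect d (G i)) l (𝓝 0)) {κ : ℝ} (hκ : 0 < κ) :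
    ∀ᶠ i in l, ∀ (x : V i) (k : ℕ),
      (1 / Real.log ((d : ℝ) - 1) + 12 / Real.log ((d : ℝ) - 1) / Real.log ((d : ℝ) - 1)
          * √(ramanujanDefect d (G i))) * Real.log (Fintype.card (V i))
        + √√(Real.log (Fintype.card (V i))) < k →
      (1 / 2) * ∑ y, |nbLaw d (G i) x k y - 1 / (Fintype.card (V i) : ℝ)| ≤ κ := by
  have h3 : (3 : ℝ) ≤ d := by exact_mod_cast hd
  have hL := log_pos_of_three_le hd
  have hℓ := tendsto_log_card hN
  set L := Real.log ((d : ℝ) - 1) with hLdef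
  have hsq : Tendsto (fun i => 12 / L * √(ramanujanDefect d (G i))) l (𝓝 0) := by
    simpa using hη.sqrt.const_mul (12 / L)
  have hlim : Tendsto (fun g : ℝ => (1 + 3 * (2 / L * g ^ 4 + g)) * (1 + 12 / L)
      * Real.exp (-(L / 4) * g)) atTop (𝓝 0) := by
    refine (tendsto_quartic_mul_exp_neg (1 + 12 / L) (3 * (1 + 12 / L)) (6 / L * (1 + 12 / L))
      (show 0 < L / 4 by positivity)).congr fun g => ?_
    ring
  have hg := hlim.comp (tendsto_sqrt_atTop' (tendsto_sqrt_atTop' hℓ))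
  filter_upwards [hη.eventually (eventually_le_nhds zero_lt_one),
    hsq.eventually (eventually_le_nhds zero_lt_one), hℓ.eventually_gt_atTop 0,
    hN.eventually_gt_atTop 0, hg.eventually (eventually_le_nhds hκ)] with i h1 h2 h4 h5 h6 x k hk
  refine (half_sum_abs_nbLaw_sub_le hd (hreg i) h1 x k).trans (le_trans ?_ h6)
  have hcard : (0 : ℝ) < Fintype.card (V i) := by exact_mod_cast h5
  have hd1 : (0 : ℝ) < d - 1 := by linarith
  have hg4 : (√√(Real.log (Fintype.card (V i)))) ^ 4 = Real.log (Fintype.card (V i)) := by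
    rw [show 4 = 2 * 2 by norm_num, pow_mul, Real.sq_sqrt (Real.sqrt_nonneg _), Real.sq_sqrt h4.le]
  simp only [Function.comp_apply, hg4]
  refine le_trans (le_of_eq ?_)
    (spectral_exponent_le hL (Real.sqrt_nonneg _) h2 (Real.sqrt_nonneg _) h4.le rfl hk)
  have e1 : √(Fintype.card (V i) : ℝ) = Real.exp (Real.log (Fintype.card (V i)) / 2) := by
    rw [Real.exp_half, Real.exp_log hcard]
  have e2 : √((d : ℝ) - 1) = Real.exp (L / 2) := by
    rw [Real.exp_half, Real.exp_log hd1]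
  rw [e1, e2, ← Real.exp_nat_mul, ← Real.exp_nat_mul, mul_div_assoc, ← Real.exp_sub, mul_left_comm,
    ← Real.exp_add]
  congr 2
  ring

/-- Upper bound for the mixing time at a fixed point of the Gaussian profile. -/
lemma eventually_mixingTime_le (hd : 3 ≤ d) (hreg : ∀ i, (G i).IsRegularOfDegree d)
    (hN : Tendsto (fun i => Fintype.card (V i)) l atTop)
    (hη : Tendsto (fun i => ramanujanDefect d (G i)) l (𝓝 0)) (s : ℝ) {δ : ℝ} (hδ : 0 < δ) :
    ∀ᶠ i in l, mixingTime d (G i) (gaussianTail d s) ≠ ⊤ ∧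
      ((mixingTime d (G i) (gaussianTail d s)).toNat : ℝ) ≤
        ((d : ℝ) / (((d : ℝ) - 2) * Real.log ((d : ℝ) - 1))
          + 12 * d / ((d - 2) * Real.log ((d : ℝ) - 1) ^ 2) * √(ramanujanDefect d (G i)))
            * Real.log (Fintype.card (V i))
          + (s + δ) * √(Real.log (Fintype.card (V i))) := by
  have h3 : (3 : ℝ) ≤ d := by exact_mod_cast hd
  have h2 : (0 : ℝ) < d - 2 := by linarith
  have hL := log_pos_of_three_le hd
  have hℓ := tendsto_log_card hN
  set L := Real.log ((d : ℝ) - 1) with hLdef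
  set c := (d : ℝ) / (((d : ℝ) - 2) * L) with hc
  have hc0 : 0 < c := by positivity
  -- Slack `12/L²` in the radius, divided by the speed `(d-2)/d`.
  set C := 12 * (d : ℝ) / ((d - 2) * L ^ 2) with hC
  set ℓ : ι → ℝ := fun i => Real.log (Fintype.card (V i)) with hℓdef
  set η : ι → ℝ := fun i => ramanujanDefect d (G i) with hηdef
  have he : Tendsto (fun i => C * √(η i)) l (𝓝 0) := by
    simpa using hη.sqrt.const_mul C
  set a : ι → ℝ := fun i => (c + C * √(η i)) * ℓ i + (s + δ) * √(ℓ i) with ha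
  set r : ι → ℝ := fun i => (1 / L + 12 / L / L * √(η i)) * ℓ i + √√(ℓ i) with hr
  have hapos : ∀ᶠ i in l, 0 < a i := eventually_affine_sqrt_pos hℓ hc0 he (s + δ)
  have hconv : Tendsto (fun i => walkCdf (((d : ℝ) - 1) / d) ⌊a i⌋₊ (r i)) l
      (𝓝 (gaussianTail d (s + δ))) := by
    refine tendsto_walkCdf_gaussianTail hd hℓ (tendsto_floor_affine_sqrt_div hℓ hc0 he (s + δ)) ?_
    have h := ((tendsto_quarter_div_sqrt hℓ).add
      ((tendsto_sub_floor_div_sqrt hℓ (hapos.mono fun _ h => h.le)).const_mul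
        (((d : ℝ) - 2) / d))).sub_const (((d : ℝ) - 2) / d * (s + δ))
    rw [mul_zero, add_zero, zero_sub] at h
    refine h.congr' ?_
    filter_upwards [hℓ.eventually_gt_atTop 0] with i hi
    have hs := Real.sqrt_pos.2 hi
    have e : r i = √√(ℓ i) + ((d : ℝ) - 2) / d * (a i - (s + δ) * √(ℓ i)) := by
      simp only [hr, ha, hc, hC]
      field_simp
      ring
    rw [e]
    field_simp
    ring
  have hlt : gaussianTail d (s + δ) < gaussianTail d s := strictAnti_gaussianTail hd (by linarith)
  -- The extra time `δ √(log n)` opens a gap between the tails, shared by the central limit error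
  -- and `κ`.
  obtain ⟨m, hm1, hm2⟩ := exists_between hlt
  filter_upwards [hconv.eventually (eventually_lt_nhds hm1), hapos,
    eventually_nbLaw_close hd hreg hN hη (sub_pos.2 hm2)] with i h1 hai h4
  have hle : mixingTime d (G i) (gaussianTail d s) ≤ (⌊a i⌋₊ : ℕ) := by
    refine mixingTime_le fun x => ?_
    have := tvDist_le_of_nbLaw hd (hreg i) x ⌊a i⌋₊ (sub_pos.2 hm2).le (h4 x)
    linarith
  refine ⟨ne_top_of_le_ne_top (ENat.natCast_ne_top _) hle, ?_⟩
  refine le_trans ?_ (Nat.floor_le hai.le)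
  exact_mod_cast ENat.toNat_le_of_le_natCast hle

/-- Lower bound for the mixing time at a fixed point of the Gaussian profile. -/
lemma eventually_le_mixingTime (hd : 3 ≤ d) (hreg : ∀ i, (G i).IsRegularOfDegree d)
    (hN : Tendsto (fun i => Fintype.card (V i)) l atTop) (s : ℝ) {δ : ℝ} (hδ : 0 < δ) :
    ∀ᶠ i in l, mixingTime d (G i) (gaussianTail d s) ≠ ⊤ →
      (d : ℝ) / (((d : ℝ) - 2) * Real.log ((d : ℝ) - 1)) * Real.log (Fintype.card (V i))
          + (s - δ) * √(Real.log (Fintype.card (V i)))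
        ≤ ((mixingTime d (G i) (gaussianTail d s)).toNat : ℝ) := by
  have h3 : (3 : ℝ) ≤ d := by exact_mod_cast hd
  have h2 : (0 : ℝ) < d - 2 := by linarith
  have hd1 : (0 : ℝ) < d - 1 := by linarith
  have hL := log_pos_of_three_le hd
  have hℓ := tendsto_log_card hN
  set L := Real.log ((d : ℝ) - 1) with hLdef
  set c := (d : ℝ) / (((d : ℝ) - 2) * L) with hc
  have hc0 : 0 < c := by positivity
  set ℓ : ι → ℝ := fun i => Real.log (Fintype.card (V i)) with hℓdef
  -- The summand `0` matches the form `c + e i` of the asymptotic lemmas.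
  set a : ι → ℝ := fun i => (c + 0) * ℓ i + (s - δ) * √(ℓ i) with ha
  set b : ι → ℝ := fun i => (1 / L + 0) * ℓ i - √√(ℓ i) with hb
  have hapos : ∀ᶠ i in l, 0 < a i :=
    eventually_affine_sqrt_pos hℓ hc0 tendsto_const_nhds (s - δ)
  have hgtop := tendsto_sqrt_atTop' (tendsto_sqrt_atTop' hℓ)
  have hbpos : ∀ᶠ i in l, 0 < b i := by
    filter_upwards [eventually_affine_sqrt_pos hℓ (show 0 < 1 / L by positivity)
      tendsto_const_nhds (-1), hgtop.eventually_ge_atTop 1] with i hi hi'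
    have : √√(ℓ i) ≤ √(ℓ i) := by
      nlinarith [Real.sq_sqrt (Real.sqrt_nonneg (ℓ i))]
    simp only [hb]
    linarith
  have hlt : gaussianTail d s < gaussianTail d (s - δ) := strictAnti_gaussianTail hd (by linarith)
  obtain ⟨w, hw1, hw2⟩ := exists_between hlt
  -- Half of the gap pays for the return probability to the root, the other half for the volume of
  -- the ball.
  obtain ⟨m, hm⟩ : ∃ m : ℕ, (((d : ℝ) - 1)⁻¹) ^ (2 * m) < (w - gaussianTail d s) / 2 := by
    obtain ⟨m, hm⟩ := exists_pow_lt_of_lt_one (show 0 < (w - gaussianTail d s) / 2 by linarith)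
      (show ((d : ℝ) - 1)⁻¹ < 1 from inv_lt_one_of_one_lt₀ (by linarith))
    refine ⟨m, (pow_le_pow_of_le_one (by positivity) ?_ (by omega)).trans_lt hm⟩
    exact inv_le_one_of_one_le₀ (by linarith)
  have hconv : Tendsto (fun i => walkCdf (((d : ℝ) - 1) / d) ⌊a i⌋₊ ((⌊b i⌋₊ : ℝ) - (2 * m : ℕ))) l
      (𝓝 (gaussianTail d (s - δ))) := by
    refine tendsto_walkCdf_gaussianTail hd hℓ
      (tendsto_floor_affine_sqrt_div hℓ hc0 tendsto_const_nhds (s - δ)) ?_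
    have hconst : Tendsto (fun i => ((2 * m : ℕ) : ℝ) / √(ℓ i)) l (𝓝 0) :=
      tendsto_const_nhds.div_atTop (tendsto_sqrt_atTop' hℓ)
    have h := (((((tendsto_sub_floor_div_sqrt hℓ (hapos.mono fun _ h => h.le)).const_mul
        (((d : ℝ) - 2) / d))).sub (tendsto_sub_floor_div_sqrt hℓ (hbpos.mono fun _ h => h.le))).sub
        (tendsto_quarter_div_sqrt hℓ)).sub hconst |>.sub_const (((d : ℝ) - 2) / d * (s - δ))
    rw [mul_zero, sub_zero, sub_zero, sub_zero, zero_sub] at h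
    refine h.congr' ?_
    filter_upwards [hℓ.eventually_gt_atTop 0] with i hi
    have hs := Real.sqrt_pos.2 hi
    have e : b i = ((d : ℝ) - 2) / d * (a i - (s - δ) * √(ℓ i)) - √√(ℓ i) := by
      simp only [ha, hb, hc]
      field_simp
      ring
    generalize (⌊b i⌋₊ : ℝ) = B
    rw [e]
    field_simp
    ring
  have hball : Tendsto (fun g : ℝ => (1 / L * g ^ 4 + 1) * d * Real.exp (-L * g)) atTop (𝓝 0) := by
    refine (tendsto_quartic_mul_exp_neg d 0 (1 / L * d) hL).congr fun g => ?_
    ring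
  filter_upwards [hconv.eventually (eventually_gt_nhds hw2), hapos, hbpos,
    (hball.comp hgtop).eventually (eventually_lt_nhds
      (show 0 < (w - gaussianTail d s) / 2 by linarith)),
    hℓ.eventually_gt_atTop 0, hN.eventually_gt_atTop 0] with i h4 hai hbi h5 hi hNi hfin
  have hcard : (0 : ℝ) < Fintype.card (V i) := by exact_mod_cast hNi
  obtain ⟨x⟩ : Nonempty (V i) := Fintype.card_pos_iff.1 hNi
  have hg4 : (√√(ℓ i)) ^ 4 = ℓ i := by
    rw [show 4 = 2 * 2 by norm_num, pow_mul, Real.sq_sqrt (Real.sqrt_nonneg _), Real.sq_sqrt hi.le]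
  have hR : ((⌊b i⌋₊ : ℝ) + 1) * (d * ((d : ℝ) - 1) ^ ⌊b i⌋₊) / Fintype.card (V i)
      ≤ (1 / L * ℓ i + 1) * d * Real.exp (-L * √√(ℓ i)) := by
    have hfl := Nat.floor_le hbi.le
    have e1 : ((d : ℝ) - 1) ^ ⌊b i⌋₊ = Real.exp (⌊b i⌋₊ * L) := by
      rw [Real.exp_nat_mul, Real.exp_log hd1]
    have e2 : (Fintype.card (V i) : ℝ) = Real.exp (ℓ i) := (Real.exp_log hcard).symm
    have e3 : (⌊b i⌋₊ : ℝ) * L - ℓ i ≤ -L * √√(ℓ i) := by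
      have : (⌊b i⌋₊ : ℝ) * L ≤ b i * L := by gcongr
      have e : b i * L = ℓ i - L * √√(ℓ i) := by
        simp only [hb]
        field_simp
        ring
      linarith
    rw [e1, e2, mul_div_assoc, mul_div_assoc, ← Real.exp_sub, ← mul_assoc]
    have : (⌊b i⌋₊ : ℝ) ≤ 1 / L * ℓ i := by
      have := Real.sqrt_nonneg √(ℓ i)
      simp only [hb] at hfl ⊢
      linarith
    gcongr
  simp only [Function.comp_apply, hg4] at h5
  have htv : gaussianTail d s ≤ tvDist d (G i) x ⌊a i⌋₊ := by
    have h6 := tvDist_ge hd (hreg i) x ⌊a i⌋₊ ⌊b i⌋₊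
    have h7 := walkCdf_sub_le_radialStep_pow hd ⌊b i⌋₊ ⌊a i⌋₊ m
    linarith
  have hle := add_one_le_mixingTime hd (hreg i) htv
  -- Finiteness matters: `toNat` sends `⊤` to `0`.
  rw [← ENat.natCast_toNat hfin] at hle
  have hle' : ⌊a i⌋₊ + 1 ≤ (mixingTime d (G i) (gaussianTail d s)).toNat := by exact_mod_cast hle
  have h8 : ((⌊a i⌋₊ : ℝ) + 1) ≤ ((mixingTime d (G i) (gaussianTail d s)).toNat : ℝ) := by
    exact_mod_cast hle'
  have h9 := Nat.lt_floor_add_one (a i)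
  simp only [ha, add_zero] at h8 h9 ⊢
  linarith

/-- Upper bound for the mixing time with an error term independent of the threshold. -/
lemma exists_uniform_mixingTime_le (hd : 3 ≤ d) (hreg : ∀ i, (G i).IsRegularOfDegree d)
    (hN : Tendsto (fun i => Fintype.card (V i)) l atTop)
    (hη : Tendsto (fun i => ramanujanDefect d (G i)) l (𝓝 0)) :
    ∃ (C : ℝ) (δ : ι → ℝ), Tendsto δ l (𝓝 0) ∧
      ∀ ε : ℝ, 0 < ε → ε < 1 → ∀ᶠ i in l,
        mixingTime d (G i) ε ≠ ⊤ ∧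
        ((mixingTime d (G i) ε).toNat : ℝ) ≤
          ((d : ℝ) / (((d : ℝ) - 2) * Real.log ((d : ℝ) - 1))
              + C * √(ramanujanDefect d (G i))) * Real.log (Fintype.card (V i))
            + (Φ d ε + δ i) * √(Real.log (Fintype.card (V i))) := by
  obtain ⟨C, hup⟩ : ∃ C : ℝ, ∀ s δ : ℝ, 0 < δ → ∀ᶠ i in l,
      mixingTime d (G i) (gaussianTail d s) ≠ ⊤ ∧
      ((mixingTime d (G i) (gaussianTail d s)).toNat : ℝ) ≤
        ((d : ℝ) / (((d : ℝ) - 2) * Real.log ((d : ℝ) - 1))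
          + C * √(ramanujanDefect d (G i))) * Real.log (Fintype.card (V i))
          + (s + δ) * √(Real.log (Fintype.card (V i))) :=
    ⟨_, fun s _ hδ => eventually_mixingTime_le hd hreg hN hη s hδ⟩
  -- Grid of mesh `1/(m+1)` on `[-(m+1), m+1]`; being finite, all its bounds hold eventually at
  -- once.
  have hgrid (m : ℕ) :=
    (Finset.eventually_all (Finset.Icc (-((m : ℤ) + 1) ^ 2) (((m : ℤ) + 1) ^ 2) : Finset ℤ)
      (l := l)).2 fun (j : ℤ) _ => hup ((j : ℝ) / ((m : ℝ) + 1)) (1 / ((m : ℝ) + 1)) (by positivity)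
  obtain ⟨φ, hφ, hp⟩ := exists_tendsto_atTop_of_forall_eventually hN hgrid
  have hφ' : Tendsto (fun i => (φ i : ℝ) + 1) l atTop :=
    tendsto_atTop_add_const_right _ _ (tendsto_natCast_atTop_atTop.comp hφ)
  -- One mesh for rounding `Φ d ε` up to the grid, one for the error at the grid point.
  refine ⟨C, fun i => 2 / (φ i + 1), tendsto_const_nhds.div_atTop hφ', fun ε h0 h1 => ?_⟩
  set s := Φ d ε with hs
  have hsε : gaussianTail d s = ε := gaussianTail_Φ hd h0 h1
  filter_upwards [hp, hφ'.eventually_ge_atTop (|s| + 1)] with i hi hM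
  set M : ℝ := (φ i : ℝ) + 1 with hMdef
  have hM1 : 1 ≤ M := by linarith [abs_nonneg s]
  have hM0 : 0 < M := by linarith
  have hj1 := Int.le_ceil (s * M)
  have hj2 := Int.ceil_lt_add_one (s * M)
  generalize ⌈s * M⌉ = j at hj1 hj2
  have hsM : |s| * M + 1 ≤ M ^ 2 := by nlinarith
  have hmem : j ∈ Finset.Icc (-((φ i : ℤ) + 1) ^ 2) (((φ i : ℤ) + 1) ^ 2) := by
    rw [Finset.mem_Icc]
    constructor
    · have : -M ^ 2 ≤ (j : ℝ) := by nlinarith [neg_abs_le s]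
      rw [hMdef] at this
      exact_mod_cast this
    · have : (j : ℝ) ≤ M ^ 2 := by nlinarith [le_abs_self s]
      rw [hMdef] at this
      exact_mod_cast this
  obtain ⟨hfin, hle⟩ := hi _ hmem
  have hsj : s ≤ (j : ℝ) / M := (le_div_iff₀ hM0).2 hj1
  have hjs : (j : ℝ) / M ≤ s + 1 / M := by
    rw [div_le_iff₀ hM0, add_mul, one_div, inv_mul_cancel₀ hM0.ne']
    exact hj2.le
  have hanti : mixingTime d (G i) ε ≤ mixingTime d (G i) (gaussianTail d (j / M)) := by
    rw [← hsε]
    exact antitone_mixingTime ((strictAnti_gaussianTail hd).antitone hsj)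
  refine ⟨ne_top_of_le_ne_top hfin hanti, ?_⟩
  have hnat : ((mixingTime d (G i) ε).toNat : ℝ)
      ≤ (mixingTime d (G i) (gaussianTail d (j / M))).toNat := by
    exact_mod_cast ENat.toNat_le_toNat hanti hfin
  refine hnat.trans (hle.trans ?_)
  have h2 : (2 : ℝ) / M = 1 / M + 1 / M := by ring
  have h3 : (j : ℝ) / M + 1 / M ≤ s + 2 / M := by linarith
  gcongr

lemma mixingTime_isLittleO (hd : 3 ≤ d) (hreg : ∀ i, (G i).IsRegularOfDegree d)
    (hN : Tendsto (fun i => Fintype.card (V i)) l atTop)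
    (hη : Tendsto (fun i => ramanujanDefect d (G i)) l (𝓝 0))
    (hη' : Tendsto (fun i => ramanujanDefect d (G i) * Real.log (Fintype.card (V i))) l (𝓝 0))
    {ε : ℝ} (h0 : 0 < ε) (h1 : ε < 1) :
    (∀ᶠ i in l, mixingTime d (G i) ε ≠ ⊤) ∧
      (fun i => ((mixingTime d (G i) ε).toNat : ℝ)
          - ((d : ℝ) / (((d : ℝ) - 2) * Real.log ((d : ℝ) - 1)) * Real.log (Fintype.card (V i))
              + Φ d ε * √(Real.log (Fintype.card (V i)))))
        =o[l] (fun i => √(Real.log (Fintype.card (V i)))) := by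
  obtain ⟨C, δ, hδ, hup⟩ := exists_uniform_mixingTime_le hd hreg hN hη
  have hup := hup ε h0 h1
  refine ⟨hup.mono fun _ h => h.1, isLittleO_iff.2 fun c hc => ?_⟩
  have herr := (hη'.sqrt.const_mul C).add hδ
  simp only [Real.sqrt_zero, mul_zero, add_zero] at herr
  have hlow := eventually_le_mixingTime hd hreg hN (Φ d ε) hc
  rw [gaussianTail_Φ hd h0 h1] at hlow
  filter_upwards [hup, hlow, herr.eventually (eventually_le_nhds hc),
    (tendsto_log_card hN).eventually_gt_atTop 0] with i hi hi' hie hpos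
  obtain ⟨hfin, hle⟩ := hi
  have hge := hi' hfin
  have hη0 : 0 ≤ ramanujanDefect d (G i) := le_max_left _ _
  set ℓ := Real.log (Fintype.card (V i))
  have hs := Real.sqrt_nonneg ℓ
  -- This is where `η log n → 0` makes the spectral correction negligible against `√(log n)`.
  have e : C * √(ramanujanDefect d (G i)) * ℓ = C * √(ramanujanDefect d (G i) * ℓ) * √ℓ := by
    rw [Real.sqrt_mul hη0, mul_assoc, mul_assoc, mul_assoc, Real.mul_self_sqrt hpos.le]
  have hmul := mul_le_mul_of_nonneg_right hie hs
  rw [Real.norm_eq_abs, Real.norm_eq_abs, abs_of_nonneg hs, abs_le]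
  rw [add_mul] at hmul
  rw [add_mul, e] at hle
  constructor <;> linarith

lemma tendsto_coe_atTop_of_infinite {S : Set ℕ} (hS : S.Infinite) :
    Tendsto (fun n : S => (n : ℕ)) atTop atTop := by
  refine tendsto_atTop.2 fun b => ?_
  obtain ⟨n, hn, hb⟩ := hS.exists_gt b
  filter_upwards [eventually_ge_atTop (⟨n, hn⟩ : S)] with m hm
  exact hb.le.trans hm

end Main

end RegularGraphWalk

open RegularGraphWalk in
theorem mainTheorem5 (d : ℕ) (hd : 3 ≤ d)
    (S : Set ℕ) (hS : S.Infinite)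
    (V : S → Type*) [∀ n, Fintype (V n)] [∀ n, DecidableEq (V n)]
    (hcard : ∀ n : S, Fintype.card (V n) = (n : ℕ))
    (G : ∀ n : S, SimpleGraph (V n)) [∀ n, DecidableRel (G n).Adj]
    (hreg : ∀ n : S, (G n).IsRegularOfDegree d)
    (hη : Tendsto (fun n : S => ramanujanDefect d (G n)) atTop (𝓝 0)) :
    (∃ (C : ℝ) (δ : S → ℝ), Tendsto δ atTop (𝓝 0) ∧
      ∀ ε : ℝ, 0 < ε → ε < 1 → ∀ᶠ n : S in atTop,
        mixingTime d (G n) ε ≠ ⊤ ∧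
        ((mixingTime d (G n) ε).toNat : ℝ) ≤
          ((d : ℝ) / (((d : ℝ) - 2) * Real.log ((d : ℝ) - 1))
              + C * √(ramanujanDefect d (G n))) * Real.log ((n : ℕ) : ℝ)
            + (Φ d ε + δ n) * √(Real.log ((n : ℕ) : ℝ))) ∧
    (Tendsto (fun n : S => ramanujanDefect d (G n) * Real.log ((n : ℕ) : ℝ)) atTop (𝓝 0) →
      ∀ ε : ℝ, 0 < ε → ε < 1 →
        (∀ᶠ n : S in atTop, mixingTime d (G n) ε ≠ ⊤) ∧
        (fun n : S => ((mixingTime d (G n) ε).toNat : ℝ)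
            - ((d : ℝ) / (((d : ℝ) - 2) * Real.log ((d : ℝ) - 1)) * Real.log ((n : ℕ) : ℝ)
                + Φ d ε * √(Real.log ((n : ℕ) : ℝ))))
          =o[atTop] (fun n : S => √(Real.log ((n : ℕ) : ℝ)))) := by

  have hN : Tendsto (fun n : S => Fintype.card (V n)) atTop atTop := by
    simpa only [hcard] using tendsto_coe_atTop_of_infinite hS
  constructor
  · simpa only [hcard] using exists_uniform_mixingTime_le hd hreg hN hη
  · intro hη' ε h0 h1
    simpa only [hcard] using
      mixingTime_isLittleO hd hreg hN hη (by simpa only [hcard] using hη') h0 h1
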